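/- Let $1\le p<\infty$, let $\theta,r,\lambda\in(0,\infty)$, and let $k$ be an integer with $k>r+\lambda$. Let $\varphi$ be a real function on $(0,1]$ which on $(0,1)$ is non-negative, continuous and not identically zero, and for which there are positive constants $C_1,C_2$ with $\varphi(\delta_1)\le C_1\varphi(\delta_2)$ for $0<\delta_1\le\delta_2\le1$ and $\varphi(2\delta)\le C_2\varphi(\delta)$ for $0<\delta\le\frac12$. For a $2\pi$-periodic $f\in L_p$ put $$\omega_k(f,t)_p=\sup_{|h|\le t}\|\Delta_h^kf\|_p,\qquad \Delta_h^kf(x)=\sum_{\nu=0}^k(-1)^{k-\nu}\binom k\nu f(x+\nu h),$$ where $\|\cdot\|_p$ is the $L_p$ norm over a period. The class $N_p=N_p(\theta,r,\lambda,k,\varphi)$ consists of all $2\pi$-periodic $f\in L_p$ for which there is a constant $C>0$ such that for all $\delta\in(0,1)$ $$\biggl(\int_0^\delta t^{-r\theta-1}\omega_k(f,t)_p^\theta\,dt+\delta^{\lambda\theta}\int_\delta^1t^{-(r+\lambda)\theta-1}\omega_k(f,t)_p^\theta\,dt\biggr)^{1/\theta}\le C\varphi(\delta).$$ Let $f\in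 L_p$ be $2\pi$-periodic with Fourier series $\sum_{\nu=1}^\infty\lambda_\nu\cos\nu x$, where $\lambda_\nu=a_\mu\ge0$ if $\nu=2^\mu$ ($\mu=0,1,2,\dots$) and $\lambda_\nu=0$ if $\nu$ is not a power of $2$. Then $f\in N_p$ if and only if there is a constant $C>0$ such that for all integers $m\ge1$ $$\biggl(\sum_{\nu=m+1}^\infty\lambda_\nu^\theta\nu^{r\theta}+m^{-\lambda\theta}\sum_{\nu=1}^m\lambda_\nu^\theta\nu^{(r+\lambda)\theta}\biggr)^{1/\theta}\le C\varphi\Bigl(\frac1m\Bigr).$$ Moreover, $f\in N_p$ if and only if there is a constant $C>0$ such that for all integers $n\ge0$ $$\sum_{\mu=n+1}^\infty a_\mu^\theta2^{\mu r\theta}+2^{-n\lambda\theta}\sum_{\mu=0}^na_\mu^\theta2^{\mu(r+\lambda)\theta}\le C\varphi\Bigl(\frac1{2^n}\Bigr)^\theta.$$ -/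

import Mathlib

open MeasureTheory
open scoped ENNReal

noncomputable section

namespace NikolskiiBesov

/-- The `L_p` norm over one period `(0, 2π]`. -/
def periodNorm (p : ℝ≥0∞) (f : ℝ → ℝ) : ℝ≥0∞ :=
  eLpNorm f p (volume.restrict (Set.Ioc 0 (2 * Real.pi)))

/-- `f` is a `2π`-periodic function of class `L_p`. -/
def IsPeriodicLp (p : ℝ≥0∞) (f : ℝ → ℝ) : Prop :=
  Function.Periodic f (2 * Real.pi) ∧
    MemLp f p (volume.restrict (Set.Ioc 0 (2 * Real.pi)))

/-- The modulus of smoothness `ω_k(f, t)_p = sup_{|h| ≤ t} ‖Δ_h^k f‖_p`, where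
`Δ_h^k f (x) = ∑_{ν ≤ k} (-1)^(k-ν) (k choose ν) f (x + ν h)` is the `k`-th iterate
of `f ↦ f (· + h) - f`. -/
def modulus (p : ℝ≥0∞) (k : ℕ) (f : ℝ → ℝ) (t : ℝ) : ℝ≥0∞ :=
  ⨆ (h : ℝ) (_ : |h| ≤ t), periodNorm p ((fwdDiff h)^[k] f)

/-- The conditions on the majorant `φ`: non-negative, continuous and not identically zero
on `(0, 1)`, almost increasing, and satisfying the doubling condition. -/
structure IsMajorant (φ : ℝ → ℝ) : Prop where
  nonneg : ∀ δ ∈ Set.Ioo (0 : ℝ) 1, 0 ≤ φ δ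
  continuousOn : ContinuousOn φ (Set.Ioo 0 1)
  ne_zero : ∃ δ ∈ Set.Ioo (0 : ℝ) 1, φ δ ≠ 0
  almost_mono : ∃ C : ℝ, 0 < C ∧ ∀ δ₁ δ₂ : ℝ, 0 < δ₁ → δ₁ ≤ δ₂ → δ₂ ≤ 1 → φ δ₁ ≤ C * φ δ₂
  doubling : ∃ C : ℝ, 0 < C ∧ ∀ δ : ℝ, 0 < δ → δ ≤ 1 / 2 → φ (2 * δ) ≤ C * φ δ

/-- The quantity
`(∫_0^δ t^(-rθ-1) ω_k(f,t)_p^θ dt + δ^(λθ) ∫_δ^1 t^(-(r+λ)θ-1) ω_k(f,t)_p^θ dt)^(1/θ)`,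
with value `∞` if an integral diverges. -/
def besovIntegral (p : ℝ≥0∞) (θ r lam : ℝ) (k : ℕ) (f : ℝ → ℝ) (δ : ℝ) : ℝ≥0∞ :=
  ((∫⁻ t in Set.Ioc 0 δ, ENNReal.ofReal (t ^ (-(r * θ) - 1)) * modulus p k f t ^ θ)
    + ENNReal.ofReal (δ ^ (lam * θ)) *
      ∫⁻ t in Set.Ioc δ 1,
        ENNReal.ofReal (t ^ (-((r + lam) * θ) - 1)) * modulus p k f t ^ θ) ^ (1 / θ)

/-- The Nikol'skii–Besov class `N_p` with parameters `θ, r, λ, k` and majorant `φ`. -/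
def classN (p : ℝ≥0∞) (θ r lam : ℝ) (k : ℕ) (φ : ℝ → ℝ) : Set (ℝ → ℝ) :=
  {f | IsPeriodicLp p f ∧
    ∃ C : ℝ, 0 < C ∧ ∀ δ ∈ Set.Ioo (0 : ℝ) 1,
      besovIntegral p θ r lam k f δ ≤ ENNReal.ofReal (C * φ δ)}

/-- The Fourier series of `f` is `∑_{ν ≥ 1} c_ν cos νx`. -/
def HasCosineSeries (f : ℝ → ℝ) (c : ℕ → ℝ) : Prop :=
  (∫ x in (0 : ℝ)..(2 * Real.pi), f x) = 0 ∧
    ∀ ν : ℕ, 1 ≤ ν →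
      (1 / Real.pi) * (∫ x in (0 : ℝ)..(2 * Real.pi), f x * Real.cos (ν * x)) = c ν ∧
      (1 / Real.pi) * (∫ x in (0 : ℝ)..(2 * Real.pi), f x * Real.sin (ν * x)) = 0

/-- `c_ν = a_μ ≥ 0` if `ν = 2^μ`, and `c_ν = 0` if `ν ≥ 1` is not a power of two. -/
def IsLacunary (c a : ℕ → ℝ) : Prop :=
  (∀ μ : ℕ, 0 ≤ a μ ∧ c (2 ^ μ) = a μ) ∧
    ∀ ν : ℕ, 1 ≤ ν → (∀ μ : ℕ, ν ≠ 2 ^ μ) → c ν = 0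

/-- `∑_{ν > m} c_ν^θ ν^(rθ) + m^(-λθ) ∑_{ν=1}^m c_ν^θ ν^((r+λ)θ)`, possibly `∞`. -/
def coeffSum (θ r lam : ℝ) (c : ℕ → ℝ) (m : ℕ) : ℝ≥0∞ :=
  (∑' j : ℕ, ENNReal.ofReal (c (m + 1 + j) ^ θ * ((m + 1 + j : ℕ) : ℝ) ^ (r * θ)))
    + ENNReal.ofReal ((m : ℝ) ^ (-(lam * θ)) *
        ∑ ν ∈ Finset.Icc 1 m, c ν ^ θ * (ν : ℝ) ^ ((r + lam) * θ))

/-- `∑_{μ > n} a_μ^θ 2^(μrθ) + 2^(-nλθ) ∑_{μ=0}^n a_μ^θ 2^(μ(r+λ)θ)`, possibly `∞`. -/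
def dyadicSum (θ r lam : ℝ) (a : ℕ → ℝ) (n : ℕ) : ℝ≥0∞ :=
  (∑' j : ℕ, ENNReal.ofReal
      (a (n + 1 + j) ^ θ * (2 : ℝ) ^ (((n + 1 + j : ℕ) : ℝ) * r * θ)))
    + ENNReal.ofReal ((2 : ℝ) ^ (-((n : ℝ) * lam * θ)) *
        ∑ μ ∈ Finset.range (n + 1), a μ ^ θ * (2 : ℝ) ^ ((μ : ℝ) * (r + lam) * θ))

end NikolskiiBesov

end

/-! Everything reduces to the sum `S(δ) = ∑ 2^(nrθ) min(1, (2^n δ)^(λθ)) a_n^θ`. At `δ = 1/m` and `δ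
= 2^(-n)` it is exactly the two coefficient quantities (`coeffSum_eq`, `dyadicSum_eq`), because the
minimum changes branch where the sums split. The `θ`-th power of the integral quantity is, up to
constants, the same sum with `ω_k(f, 2^(-n))` in place of `a_n`, up to a shift of index.

Coefficients are bounded by the modulus: for `h = 2^(-n-1)` the operator `Δ_h^k` multiplies the
coefficient of frequency `2^n` by a nonzero constant independent of `n` (`exists_coeff_le_modulus`).
Conversely, since `r > 0`, finiteness of `S(δ)` forces `∑ a_m < ∞`; then `f` is almost everywhere
its absolutely convergent series and `ω_k(f, 2^(-n)) ≤ C ∑ a_m 2^(-k(n-m)₊)` (`modulus_le_tsum`). A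
Hardy inequality, which uses `k > r + λ`, turns this into a bound by `S(δ)` (`exists_hardy_le`). Sup
norms suffice above and `L_1` below, so no `L_p` theory of lacunary series enters.

Finally, almost monotonicity and doubling of `φ` make the bounds over all `δ`, over `1/m` and over
`2^(-n)` equivalent. -/

noncomputable section

namespace NikolskiiBesov

/-! ### Dyadic weights and weighted sums -/

/-- The weight `2^(nrθ) min(1, (2^n δ)^(λθ))`. -/
def weight (θ r lam δ : ℝ) (n : ℕ) : ℝ :=
  (2 : ℝ) ^ ((n : ℝ) * r * θ) * min 1 (((2 : ℝ) ^ n * δ) ^ (lam * θ))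

/-- The weighted sum `∑ 2^(nrθ) min(1, (2^n δ)^(λθ)) A_n^θ`. -/
def weightedSum (θ r lam : ℝ) (A : ℕ → ℝ≥0∞) (δ : ℝ) : ℝ≥0∞ :=
  ∑' n, ENNReal.ofReal (weight θ r lam δ n) * A n ^ θ

lemma weight_pos {θ r lam δ : ℝ} (hδ : 0 < δ) (n : ℕ) : 0 < weight θ r lam δ n := by
  unfold weight
  have : 0 < min 1 (((2 : ℝ) ^ n * δ) ^ (lam * θ)) := lt_min one_pos (by positivity)
  positivity

lemma min_one_mul_le {x y : ℝ} (hx : 1 ≤ x) : min 1 (x * y) ≤ x * min 1 y := by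
  rw [mul_min_of_nonneg _ _ (by linarith)]
  exact min_le_min_right _ (by linarith)

/-- With `le_weight_add`, this places the growth rate of the weight between `rθ` and `(r+λ)θ`. These
two rates are what the Hardy kernel has to beat. -/
lemma weight_add_le {θ r lam δ : ℝ} (hθ : 0 < θ) (hlam : 0 < lam) (hδ : 0 < δ) (m d : ℕ) :
    weight θ r lam δ (m + d) ≤ (2 : ℝ) ^ ((d : ℝ) * ((r + lam) * θ)) * weight θ r lam δ m := by
  unfold weight
  have h1 : ((2 : ℝ) ^ (m + d) * δ) ^ (lam * θ)
      = (2 : ℝ) ^ ((d : ℝ) * (lam * θ)) * ((2 : ℝ) ^ m * δ) ^ (lam * θ) := by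
    rw [pow_add, mul_right_comm, mul_comm, Real.mul_rpow (by positivity) (by positivity),
      Real.rpow_mul (by positivity) (d : ℝ), Real.rpow_natCast]
  have h2 : (2 : ℝ) ^ (((m + d : ℕ) : ℝ) * r * θ)
      = (2 : ℝ) ^ ((d : ℝ) * (r * θ)) * (2 : ℝ) ^ ((m : ℝ) * r * θ) := by
    rw [← Real.rpow_add two_pos]; push_cast; ring_nf
  have h3 : (2 : ℝ) ^ ((d : ℝ) * ((r + lam) * θ))
      = (2 : ℝ) ^ ((d : ℝ) * (r * θ)) * (2 : ℝ) ^ ((d : ℝ) * (lam * θ)) := by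
    rw [← Real.rpow_add two_pos]; ring_nf
  have h4 := min_one_mul_le (x := (2 : ℝ) ^ ((d : ℝ) * (lam * θ)))
    (y := ((2 : ℝ) ^ m * δ) ^ (lam * θ)) (Real.one_le_rpow one_le_two (by positivity))
  rw [h1, h2, h3]
  calc _ ≤ (2 : ℝ) ^ ((d : ℝ) * (r * θ)) * (2 : ℝ) ^ ((m : ℝ) * r * θ) *
        ((2 : ℝ) ^ ((d : ℝ) * (lam * θ)) * min 1 (((2 : ℝ) ^ m * δ) ^ (lam * θ))) := by gcongr
    _ = _ := by ring

lemma le_weight_add {θ r lam δ : ℝ} (hθ : 0 < θ) (hlam : 0 < lam) (hδ : 0 < δ) (m d : ℕ) :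
    (2 : ℝ) ^ ((d : ℝ) * (r * θ)) * weight θ r lam δ m ≤ weight θ r lam δ (m + d) := by
  unfold weight
  have h2 : (2 : ℝ) ^ (((m + d : ℕ) : ℝ) * r * θ)
      = (2 : ℝ) ^ ((d : ℝ) * (r * θ)) * (2 : ℝ) ^ ((m : ℝ) * r * θ) := by
    rw [← Real.rpow_add two_pos]; push_cast; ring_nf
  rw [h2, ← mul_assoc]
  gcongr
  · norm_num
  · omega

lemma weight_mono {θ r lam δ δ' : ℝ} (hθ : 0 < θ) (hlam : 0 < lam) (hδ : 0 < δ) (h : δ ≤ δ')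
    (n : ℕ) : weight θ r lam δ n ≤ weight θ r lam δ' n := by
  unfold weight
  gcongr

lemma weight_two_mul_le {θ r lam δ : ℝ} (hθ : 0 < θ) (hlam : 0 < lam) (hδ : 0 < δ) (n : ℕ) :
    weight θ r lam (2 * δ) n ≤ (2 : ℝ) ^ (lam * θ) * weight θ r lam δ n := by
  unfold weight
  have h1 : ((2 : ℝ) ^ n * (2 * δ)) ^ (lam * θ)
      = (2 : ℝ) ^ (lam * θ) * ((2 : ℝ) ^ n * δ) ^ (lam * θ) := by
    rw [← Real.mul_rpow (by positivity) (by positivity)]; ring_nf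
  have h4 := min_one_mul_le (x := (2 : ℝ) ^ (lam * θ))
    (y := ((2 : ℝ) ^ n * δ) ^ (lam * θ)) (Real.one_le_rpow one_le_two (by positivity))
  rw [h1, mul_left_comm]
  gcongr

lemma weightedSum_mono {θ r lam δ δ' : ℝ} (hθ : 0 < θ) (hlam : 0 < lam) (A : ℕ → ℝ≥0∞)
    (hδ : 0 < δ) (h : δ ≤ δ') : weightedSum θ r lam A δ ≤ weightedSum θ r lam A δ' := by
  unfold weightedSum
  gcongr with n
  exact weight_mono hθ hlam hδ h n

lemma weightedSum_two_mul_le {θ r lam δ : ℝ} (hθ : 0 < θ) (hlam : 0 < lam) (A : ℕ → ℝ≥0∞)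
    (hδ : 0 < δ) : weightedSum θ r lam A (2 * δ)
      ≤ ENNReal.ofReal ((2 : ℝ) ^ (lam * θ)) * weightedSum θ r lam A δ := by
  unfold weightedSum
  rw [← ENNReal.tsum_mul_left]
  refine ENNReal.tsum_le_tsum fun n => ?_
  rw [← mul_assoc, ← ENNReal.ofReal_mul (by positivity)]
  gcongr
  exact weight_two_mul_le hθ hlam hδ n

/-! ### Discrete Hardy inequality -/

/-- In truncated subtraction `(n - m) + (m - n)` is `|n - m|`, and each distance occurs for at most
two `m`. -/
lemma tsum_pow_dist_le (q : ℝ≥0∞) (n : ℕ) :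
    ∑' m : ℕ, q ^ ((n - m) + (m - n)) ≤ 2 * ∑' j : ℕ, q ^ j := by
  rw [← (ENNReal.summable (f := fun i => q ^ ((n - (i + n)) + (i + n - n)))).sum_add_tsum_nat_add'
    (f := fun m => q ^ ((n - m) + (m - n))), two_mul]
  refine add_le_add ?_ (ENNReal.tsum_le_tsum fun j => ?_)
  · rw [← Finset.sum_range_reflect]
    calc _ = ∑ j ∈ Finset.range n, q ^ (j + 1) := by
          refine Finset.sum_congr rfl fun j hj => ?_
          rw [Finset.mem_range] at hj
          congr 1; omega
      _ ≤ ∑' j : ℕ, q ^ (j + 1) := ENNReal.sum_le_tsum _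
      _ ≤ _ := by
          rw [tsum_eq_zero_add' (f := fun j => q ^ j) ENNReal.summable]
          exact le_add_self
  · apply le_of_eq; congr 1; omega

/-- For `n = m + d` the weight gains at most `2^(d(r+λ)θ)` against `2^(-kdθ)`; for `m = n + d` it
loses at least `2^(drθ)`. Of the spare `2ε`, one `ε` pays for the factor `2^(ε|n-m|)` and the other
remains as decay. -/
lemma weight_mul_kernel_le {θ r lam δ ε k : ℝ} (hθ : 0 < θ) (hlam : 0 < lam) (hδ : 0 < δ)
    (hε : 2 * ε ≤ r) (hε' : 2 * ε ≤ k - (r + lam)) (n m : ℕ) :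
    weight θ r lam δ n *
        ((2 : ℝ) ^ (-(k * (n - m : ℕ))) * (2 : ℝ) ^ (ε * ((n - m) + (m - n) : ℕ))) ^ θ
      ≤ ((2 : ℝ) ^ (-(ε * θ))) ^ ((n - m) + (m - n)) * weight θ r lam δ m := by
  rw [← Real.rpow_natCast, ← Real.rpow_mul (by positivity), ← Real.rpow_add two_pos,
    ← Real.rpow_mul (by positivity)]
  rcases le_total m n with h | h
  · obtain ⟨d, rfl⟩ := Nat.exists_eq_add_of_le h
    have e1 : m + d - m = d := by omega
    have e2 : m - (m + d) = 0 := by omega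
    rw [e1, e2, add_zero]
    calc _ ≤ (2 : ℝ) ^ ((d : ℝ) * ((r + lam) * θ)) * weight θ r lam δ m *
          (2 : ℝ) ^ ((-(k * d) + ε * d) * θ) := by
          gcongr; exact weight_add_le hθ hlam hδ m d
      _ = (2 : ℝ) ^ ((d : ℝ) * ((r + lam) * θ) + (-(k * d) + ε * d) * θ) * weight θ r lam δ m := by
          rw [Real.rpow_add two_pos]; ring
      _ ≤ _ := by
          have := (weight_pos (θ := θ) (r := r) (lam := lam) hδ m).le
          gcongr
          · norm_num
          have : 0 ≤ (d : ℝ) * θ * (k - (r + lam) - 2 * ε) :=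
            mul_nonneg (by positivity) (by linarith)
          linarith
  · obtain ⟨d, rfl⟩ := Nat.exists_eq_add_of_le h
    have e1 : n + d - n = d := by omega
    have e2 : n - (n + d) = 0 := by omega
    rw [e1, e2, zero_add]
    have := (weight_pos (θ := θ) (r := r) (lam := lam) hδ n).le
    calc _ ≤ (2 : ℝ) ^ (-(ε * θ) * d) * ((2 : ℝ) ^ ((d : ℝ) * (r * θ)) * weight θ r lam δ n) := by
          rw [← mul_assoc, ← Real.rpow_add two_pos, mul_comm]
          gcongr
          · norm_num
          have : 0 ≤ (d : ℝ) * θ * (r - 2 * ε) :=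
            mul_nonneg (by positivity) (by linarith)
          simp only [Nat.cast_zero]
          linarith
      _ ≤ _ := by
          gcongr
          exact le_weight_add hθ hlam hδ n d

/-- A weighted discrete Hardy inequality, valid for every exponent `θ > 0`. -/
lemma exists_hardy_le {θ r lam k : ℝ} (hθ : 0 < θ) (hr : 0 < r) (hlam : 0 < lam)
    (hk : r + lam < k) :
    ∃ C : ℝ≥0∞, C ≠ ∞ ∧ ∀ δ : ℝ, 0 < δ → ∀ A : ℕ → ℝ≥0∞,
      weightedSum θ r lam (fun n => ∑' m, A m * ENNReal.ofReal ((2 : ℝ) ^ (-(k * (n - m : ℕ))))) δ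
        ≤ C * weightedSum θ r lam A δ := by
  set ε : ℝ := min r (k - (r + lam)) / 2 with hεdef
  have hε : 0 < ε := by
    have : 0 < min r (k - (r + lam)) := lt_min hr (by linarith)
    positivity
  have hε1 : 2 * ε ≤ r := by have := min_le_left r (k - (r + lam)); linarith
  have hε2 : 2 * ε ≤ k - (r + lam) := by have := min_le_right r (k - (r + lam)); linarith
  have geom : ∀ x : ℝ, 0 < x →
      2 * ∑' j : ℕ, (ENNReal.ofReal ((2 : ℝ) ^ (-x))) ^ j ≠ ∞ := by
    intro x hx
    rw [ENNReal.tsum_geometric]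
    refine ENNReal.mul_ne_top (by simp) (ENNReal.inv_ne_top.2 ?_)
    rw [Ne, tsub_eq_zero_iff_le, not_le, ← ENNReal.ofReal_one]
    exact (ENNReal.ofReal_lt_ofReal_iff one_pos).2
      (Real.rpow_lt_one_of_one_lt_of_neg one_lt_two (by linarith))
  set M : ℝ≥0∞ := 2 * ∑' j : ℕ, (ENNReal.ofReal ((2 : ℝ) ^ (-ε))) ^ j with hM
  set N : ℝ≥0∞ := 2 * ∑' j : ℕ, (ENNReal.ofReal ((2 : ℝ) ^ (-(ε * θ)))) ^ j with hN
  refine ⟨M ^ θ * N, ENNReal.mul_ne_top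
    (ENNReal.rpow_ne_top_of_nonneg hθ.le (geom ε hε)) (geom _ (by positivity)), ?_⟩
  intro δ hδ A
  set D : ℕ → ℕ → ℝ := fun n m => (2 : ℝ) ^ (-(k * (n - m : ℕ))) with hD
  set E : ℕ → ℕ → ℝ := fun n m => (2 : ℝ) ^ (ε * ((n - m) + (m - n) : ℕ)) with hE
  have hDE : ∀ n m, 0 < D n m * E n m := fun n m => by positivity
  -- Instead of convexity: each `A m * D * E` is at most the `ℓ^θ` sum, and the spare factor `E⁻¹ =
  -- 2^(-ε|n-m|)` is summable. This treats `θ < 1` and `θ ≥ 1` alike.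
  have inner : ∀ n, (∑' m, A m * ENNReal.ofReal (D n m)) ^ θ
      ≤ M ^ θ * ∑' m, A m ^ θ * ENNReal.ofReal ((D n m * E n m) ^ θ) := by
    intro n
    set s := ∑' m, A m ^ θ * ENNReal.ofReal ((D n m * E n m) ^ θ) with hs
    have key : ∀ m, A m * ENNReal.ofReal (D n m * E n m) ≤ s ^ (1 / θ) := by
      intro m
      rw [one_div, ENNReal.le_rpow_inv_iff hθ, ENNReal.mul_rpow_of_nonneg _ _ hθ.le,
        ENNReal.ofReal_rpow_of_pos (hDE n m)]
      exact ENNReal.le_tsum m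
    have : ∑' m, A m * ENNReal.ofReal (D n m) ≤ s ^ (1 / θ) * M := by
      calc _ ≤ ∑' m, s ^ (1 / θ) *
            (ENNReal.ofReal ((2 : ℝ) ^ (-ε))) ^ ((n - m) + (m - n)) := by
            refine ENNReal.tsum_le_tsum fun m => ?_
            calc _ = A m * ENNReal.ofReal (D n m * E n m) *
                  (ENNReal.ofReal ((2 : ℝ) ^ (-ε))) ^ ((n - m) + (m - n)) := by
                  rw [mul_assoc, ← ENNReal.ofReal_pow (by positivity),
                    ← ENNReal.ofReal_mul (hDE n m).le, mul_assoc (D n m)]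
                  congr 2
                  rw [hE, ← Real.rpow_natCast, ← Real.rpow_mul (by positivity),
                    ← Real.rpow_add two_pos]
                  simp
              _ ≤ _ := by gcongr; exact key m
        _ ≤ _ := by
            rw [ENNReal.tsum_mul_left]
            gcongr
            exact tsum_pow_dist_le _ n
    calc _ ≤ (s ^ (1 / θ) * M) ^ θ := by gcongr
      _ = _ := by
        rw [ENNReal.mul_rpow_of_nonneg _ _ hθ.le, ← ENNReal.rpow_mul, one_div,
          inv_mul_cancel₀ hθ.ne', ENNReal.rpow_one, mul_comm]
  unfold weightedSum
  calc _ ≤ ∑' n, ENNReal.ofReal (weight θ r lam δ n) *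
        (M ^ θ * ∑' m, A m ^ θ * ENNReal.ofReal ((D n m * E n m) ^ θ)) := by
        gcongr with n; exact inner n
    _ = M ^ θ * ∑' m, ∑' n, A m ^ θ *
        ENNReal.ofReal (weight θ r lam δ n * (D n m * E n m) ^ θ) := by
        rw [ENNReal.tsum_comm, ← ENNReal.tsum_mul_left]
        refine tsum_congr fun n => ?_
        rw [mul_left_comm, ← ENNReal.tsum_mul_left]
        congr 1
        refine tsum_congr fun m => ?_
        rw [ENNReal.ofReal_mul (weight_pos hδ n).le]
        ring
    _ ≤ M ^ θ * ∑' m, N * (ENNReal.ofReal (weight θ r lam δ m) * A m ^ θ) := by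
        gcongr with m
        calc _ ≤ ∑' n, A m ^ θ * ENNReal.ofReal (weight θ r lam δ m) *
              (ENNReal.ofReal ((2 : ℝ) ^ (-(ε * θ)))) ^ ((m - n) + (n - m)) := by
              refine ENNReal.tsum_le_tsum fun n => ?_
              rw [mul_assoc]
              gcongr
              rw [← ENNReal.ofReal_pow (by positivity), ← ENNReal.ofReal_mul (weight_pos hδ m).le,
                mul_comm (weight θ r lam δ m), add_comm (m - n)]
              exact ENNReal.ofReal_le_ofReal (weight_mul_kernel_le hθ hlam hδ hε1 hε2 n m)
          _ ≤ _ := by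
              rw [ENNReal.tsum_mul_left, mul_comm N, mul_comm (A m ^ θ)]
              gcongr
              exact tsum_pow_dist_le _ m
    _ = _ := by rw [ENNReal.tsum_mul_left (a := N), ← mul_assoc]

/-! ### The coefficient conditions as weighted sums -/

lemma dyadicSum_eq {θ r lam : ℝ} (hθ : 0 < θ) (hlam : 0 < lam) {a : ℕ → ℝ} (ha : ∀ n, 0 ≤ a n)
    (n : ℕ) : dyadicSum θ r lam a n
      = weightedSum θ r lam (fun m => ENNReal.ofReal (a m)) (1 / (2 : ℝ) ^ n) := by
  unfold dyadicSum weightedSum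
  have hterm : ∀ m, ENNReal.ofReal (weight θ r lam (1 / (2 : ℝ) ^ n) m) * ENNReal.ofReal (a m) ^ θ
      = ENNReal.ofReal (a m ^ θ * weight θ r lam (1 / (2 : ℝ) ^ n) m) := fun m => by
    rw [ENNReal.ofReal_rpow_of_nonneg (ha m) hθ.le, mul_comm,
      ENNReal.ofReal_mul (Real.rpow_nonneg (ha m) θ)]
  simp_rw [hterm]
  rw [← (ENNReal.summable).sum_add_tsum_nat_add'
    (f := fun m => ENNReal.ofReal (a m ^ θ * weight θ r lam (1 / (2 : ℝ) ^ n) m)) (k := n + 1),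
    add_comm, Finset.mul_sum, ENNReal.ofReal_sum_of_nonneg]
  · congr 1
    · refine Finset.sum_congr rfl fun m hm => ?_
      rw [Finset.mem_range] at hm
      congr 1
      unfold weight
      have h1 : (2 : ℝ) ^ m * (1 / (2 : ℝ) ^ n) ≤ 1 := by
        rw [mul_one_div, div_le_one (by positivity)]
        exact pow_le_pow_right₀ one_le_two (by omega)
      rw [min_eq_right (Real.rpow_le_one (by positivity) h1 (by positivity)), mul_left_comm]
      congr 1
      rw [Real.mul_rpow (by positivity) (by positivity), one_div, Real.inv_rpow (by positivity),
        ← Real.rpow_natCast, ← Real.rpow_natCast, ← Real.rpow_mul (by positivity),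
        ← Real.rpow_mul (by positivity), ← Real.rpow_neg (by positivity),
        ← Real.rpow_add two_pos, ← Real.rpow_add two_pos, ← Real.rpow_add two_pos]
      ring_nf
    · refine tsum_congr fun j => ?_
      rw [add_comm j]
      congr 2
      unfold weight
      have h1 : 1 ≤ (2 : ℝ) ^ (n + 1 + j) * (1 / (2 : ℝ) ^ n) := by
        rw [mul_one_div, one_le_div (by positivity)]
        exact pow_le_pow_right₀ one_le_two (by omega)
      rw [min_eq_left (Real.one_le_rpow h1 (by positivity)), mul_one]
  · intro m _
    have := ha m
    positivity

lemma coeffSum_eq {θ r lam : ℝ} (hθ : 0 < θ) (hr : 0 < r) (hlam : 0 < lam) {c a : ℕ → ℝ}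
    (hca : IsLacunary c a) {m : ℕ} (hm : 1 ≤ m) : coeffSum θ r lam c m
      = weightedSum θ r lam (fun m => ENNReal.ofReal (a m)) (1 / (m : ℝ)) := by
  have hc : ∀ ν, 1 ≤ ν → 0 ≤ c ν := by
    intro ν hν
    by_cases h : ∃ μ, ν = 2 ^ μ
    · obtain ⟨μ, rfl⟩ := h
      rw [(hca.1 μ).2]; exact (hca.1 μ).1
    · rw [hca.2 ν hν (not_exists.1 h)]
  have hm0 : (0 : ℝ) < m := by exact_mod_cast hm
  set F : ℕ → ℝ≥0∞ := fun ν => ENNReal.ofReal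
    (c ν ^ θ * ((ν : ℝ) ^ (r * θ) * min 1 (((ν : ℝ) * (1 / m)) ^ (lam * θ)))) with hF
  have h1 : weightedSum θ r lam (fun m => ENNReal.ofReal (a m)) (1 / (m : ℝ))
      = ∑' μ : ℕ, F (2 ^ μ) := by
    refine tsum_congr fun μ => ?_
    rw [ENNReal.ofReal_rpow_of_nonneg (hca.1 μ).1 hθ.le, mul_comm,
      ← ENNReal.ofReal_mul (Real.rpow_nonneg (hca.1 μ).1 θ), hF]
    simp only [(hca.1 μ).2, weight]
    push_cast
    rw [mul_assoc, Real.rpow_mul (by positivity) (μ : ℝ), Real.rpow_natCast]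
  have h2 : ∑' μ : ℕ, F (2 ^ μ) = ∑' ν : ℕ, F ν := by
    refine (Nat.pow_right_injective le_rfl).tsum_eq (f := F) ?_
    intro ν hν
    by_contra hcon
    refine hν ?_
    -- `c 0` is unconstrained, but the term `ν = 0` vanishes because `0^(rθ) = 0`.
    rcases Nat.eq_zero_or_pos ν with rfl | hpos
    · simp [hF, Real.zero_rpow (mul_pos hr hθ).ne']
    · have : c ν = 0 := hca.2 ν hpos fun μ h => hcon ⟨μ, h.symm⟩
      simp [hF, this, Real.zero_rpow hθ.ne']
  rw [h1, h2, ← (ENNReal.summable).sum_add_tsum_nat_add' (f := F) (k := m + 1)]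
  unfold coeffSum
  rw [add_comm]
  congr 1
  · rw [Finset.mul_sum, ENNReal.ofReal_sum_of_nonneg]
    · have hsub : Finset.Icc 1 m ⊆ Finset.range (m + 1) := fun ν hν => by
        rw [Finset.mem_Icc] at hν
        rw [Finset.mem_range]; omega
      rw [← Finset.sum_subset hsub]
      · refine Finset.sum_congr rfl fun ν hν => ?_
        rw [Finset.mem_Icc] at hν
        have hν0 : (0 : ℝ) < ν := by exact_mod_cast hν.1
        simp only [hF]
        congr 1
        have h1 : (ν : ℝ) * (1 / m) ≤ 1 := by
          rw [mul_one_div, div_le_one hm0]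
          exact_mod_cast hν.2
        rw [min_eq_right (Real.rpow_le_one (by positivity) h1 (by positivity)), mul_left_comm]
        congr 1
        rw [Real.mul_rpow (by positivity) (by positivity), one_div, Real.inv_rpow (by positivity),
          ← Real.rpow_neg (by positivity), ← mul_assoc, ← Real.rpow_add hν0, mul_comm]
        ring_nf
      · intro ν hν hν'
        rw [Finset.mem_range] at hν
        rw [Finset.mem_Icc] at hν'
        have : ν = 0 := by omega
        simp [hF, this, Real.zero_rpow (mul_pos hr hθ).ne']
    · intro ν hν
      have := hc ν (Finset.mem_Icc.1 hν).1
      positivity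
  · refine tsum_congr fun j => ?_
    rw [add_comm j]
    simp only [hF]
    have h1 : 1 ≤ ((m + 1 + j : ℕ) : ℝ) * (1 / m) := by
      rw [mul_one_div, one_le_div hm0]
      exact_mod_cast (by omega)
    rw [min_eq_left (Real.one_le_rpow h1 (by positivity)), mul_one]

/-! ### Discretisation of the integral -/

lemma modulus_mono (p : ℝ≥0∞) (k : ℕ) (f : ℝ → ℝ) : Monotone (modulus p k f) := by
  intro s t hst
  refine iSup₂_le fun h hh => ?_
  exact le_iSup₂ (f := fun (h : ℝ) (_ : |h| ≤ t) => periodNorm p ((fwdDiff h)^[k] f)) h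
    (hh.trans hst)

/-- The density `t^(-rθ-1) min(1, (δ/t)^(λθ))`. -/
def density (θ r lam δ t : ℝ) : ℝ := t ^ (-(r * θ) - 1) * min 1 ((δ / t) ^ (lam * θ))

lemma density_antitone {θ r lam δ s t : ℝ} (hθ : 0 < θ) (hr : 0 < r) (hlam : 0 < lam) (hδ : 0 < δ)
    (hs : 0 < s) (hst : s ≤ t) : density θ r lam δ t ≤ density θ r lam δ s := by
  have ht := hs.trans_le hst
  have h1 : t ^ (-(r * θ) - 1) ≤ s ^ (-(r * θ) - 1) :=
    Real.rpow_le_rpow_of_nonpos hs hst (by nlinarith [mul_pos hr hθ])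
  unfold density
  gcongr

lemma density_half_pow (θ r lam δ : ℝ) (n : ℕ) :
    density θ r lam δ ((1 / 2) ^ n) * (1 / 2) ^ n = weight θ r lam δ n := by
  unfold density weight
  have h1 : δ / (1 / 2) ^ n = (2 : ℝ) ^ n * δ := by
    rw [one_div, inv_pow, div_inv_eq_mul, mul_comm]
  have h2 : ((1 / 2 : ℝ) ^ n) ^ (-(r * θ) - 1) * (1 / 2) ^ n = (2 : ℝ) ^ ((n : ℝ) * r * θ) := by
    have e : (1 / 2 : ℝ) ^ n = (2 : ℝ) ^ (-(n : ℝ)) := by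
      rw [one_div, inv_pow, Real.rpow_neg (by positivity), Real.rpow_natCast]
    rw [e, ← Real.rpow_mul (by positivity), ← Real.rpow_add two_pos]
    ring_nf
  rw [h1, mul_right_comm, h2]

/-- The minimum in `density` is `1` for `t ≤ δ` and `(δ/t)^(λθ)` for `t > δ`, which merges the two
integrals. -/
lemma besovIntegral_eq (p : ℝ≥0∞) {θ r lam δ : ℝ} (hθ : 0 < θ) (hlam : 0 < lam) (k : ℕ)
    (f : ℝ → ℝ) (hδ : 0 < δ) (hδ1 : δ ≤ 1) :
    besovIntegral p θ r lam k f δ =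
      (∫⁻ t in Set.Ioc 0 1, ENNReal.ofReal (density θ r lam δ t) * modulus p k f t ^ θ) ^ (1 / θ) := by
  unfold besovIntegral
  congr 1
  rw [← Set.Ioc_union_Ioc_eq_Ioc hδ.le hδ1,
    lintegral_union measurableSet_Ioc (Set.Ioc_disjoint_Ioc_of_le le_rfl),
    ← lintegral_const_mul' _ _ ENNReal.ofReal_ne_top]
  congr 1
  · refine setLIntegral_congr_fun measurableSet_Ioc fun t ht => ?_
    have h1 : 1 ≤ δ / t := (one_le_div ht.1).2 ht.2
    simp only [density]
    rw [min_eq_left (Real.one_le_rpow h1 (by positivity)), mul_one]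
  · refine setLIntegral_congr_fun measurableSet_Ioc fun t ht => ?_
    have ht0 : 0 < t := hδ.trans ht.1
    have h1 : δ / t ≤ 1 := (div_le_one ht0).2 ht.1.le
    simp only [density]
    rw [min_eq_right (Real.rpow_le_one (by positivity) h1 (by positivity)), ← mul_assoc,
      ← ENNReal.ofReal_mul (by positivity)]
    congr 2
    rw [Real.div_rpow hδ.le ht0.le, div_eq_mul_inv, ← Real.rpow_neg ht0.le, mul_left_comm,
      ← Real.rpow_add ht0]
    ring_nf

lemma lintegral_Ioc_zero_one_eq_tsum (F : ℝ → ℝ≥0∞) :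
    ∫⁻ t in Set.Ioc (0 : ℝ) 1, F t
      = ∑' n : ℕ, ∫⁻ t in Set.Ioc ((1 / 2 : ℝ) ^ (n + 1)) ((1 / 2 : ℝ) ^ n), F t := by
  have hanti : Antitone fun n : ℕ => (1 / 2 : ℝ) ^ n :=
    pow_right_anti₀ (by norm_num) (by norm_num)
  have hU : Set.Ioc (0 : ℝ) 1 = ⋃ n : ℕ, Set.Ioc ((1 / 2 : ℝ) ^ (n + 1)) ((1 / 2 : ℝ) ^ n) := by
    ext t
    simp only [Set.mem_Ioc, Set.mem_iUnion]
    constructor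
    · rintro ⟨h0, h1⟩
      exact exists_nat_pow_near_of_lt_one h0 h1 (by norm_num) (by norm_num)
    · rintro ⟨n, h0, h1⟩
      exact ⟨lt_trans (by positivity) h0, h1.trans (pow_le_one₀ (by norm_num) (by norm_num))⟩
  rw [hU, lintegral_iUnion (fun _ => measurableSet_Ioc)]
  simpa using! hanti.pairwise_disjoint_on_Ioc_succ

lemma volume_dyadic_Ioc (n : ℕ) :
    volume (Set.Ioc ((1 / 2 : ℝ) ^ (n + 1)) ((1 / 2 : ℝ) ^ n))
      = ENNReal.ofReal ((1 / 2) ^ (n + 1)) := by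
  rw [Real.volume_Ioc]; congr 1; ring

/-- On each dyadic interval the density is taken at the left end and `W` at the right end. Density
times length is then the weight of index `n + 1`, and moving back to `n` costs the constant. -/
lemma lintegral_density_le {θ r lam δ : ℝ} (hθ : 0 < θ) (hr : 0 < r) (hlam : 0 < lam) (hδ : 0 < δ)
    {W : ℝ → ℝ≥0∞} (hW : Monotone W) :
    ∫⁻ t in Set.Ioc (0 : ℝ) 1, ENNReal.ofReal (density θ r lam δ t) * W t ^ θ
      ≤ ENNReal.ofReal ((2 : ℝ) ^ ((r + lam) * θ)) *
        weightedSum θ r lam (fun n => W ((1 / 2) ^ n)) δ := by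
  unfold weightedSum
  rw [lintegral_Ioc_zero_one_eq_tsum, ← ENNReal.tsum_mul_left]
  refine ENNReal.tsum_le_tsum fun n => ?_
  calc _ ≤ ∫⁻ _ in Set.Ioc ((1 / 2 : ℝ) ^ (n + 1)) ((1 / 2 : ℝ) ^ n),
        ENNReal.ofReal (density θ r lam δ ((1 / 2) ^ (n + 1))) * W ((1 / 2) ^ n) ^ θ := by
        refine setLIntegral_mono' measurableSet_Ioc fun t ht => ?_
        gcongr
        · exact density_antitone hθ hr hlam hδ (by positivity) ht.1.le
        · exact hW ht.2
    _ = ENNReal.ofReal (weight θ r lam δ (n + 1)) * W ((1 / 2) ^ n) ^ θ := by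
        rw [setLIntegral_const, volume_dyadic_Ioc, mul_right_comm,
          ← ENNReal.ofReal_mul' (by positivity), density_half_pow]
    _ ≤ _ := by
        rw [← mul_assoc, ← ENNReal.ofReal_mul (by positivity)]
        gcongr
        simpa using weight_add_le (r := r) hθ hlam hδ n 1

/-- The opposite end points are used. The interval has half the length of its right end point, hence
the factor `2`; `W` is evaluated at `2^(-n-1)`, the scale used in `exists_coeff_le_modulus`. -/
lemma le_lintegral_density {θ r lam δ : ℝ} (hθ : 0 < θ) (hr : 0 < r) (hlam : 0 < lam) (hδ : 0 < δ)
    {W : ℝ → ℝ≥0∞} (hW : Monotone W) :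
    weightedSum θ r lam (fun n => W ((1 / 2) ^ (n + 1))) δ
      ≤ 2 * ∫⁻ t in Set.Ioc (0 : ℝ) 1, ENNReal.ofReal (density θ r lam δ t) * W t ^ θ := by
  unfold weightedSum
  rw [lintegral_Ioc_zero_one_eq_tsum, ← ENNReal.tsum_mul_left]
  refine ENNReal.tsum_le_tsum fun n => ?_
  calc _ = 2 * ∫⁻ _ in Set.Ioc ((1 / 2 : ℝ) ^ (n + 1)) ((1 / 2 : ℝ) ^ n),
        ENNReal.ofReal (density θ r lam δ ((1 / 2) ^ n)) * W ((1 / 2) ^ (n + 1)) ^ θ := by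
        rw [setLIntegral_const, volume_dyadic_Ioc, mul_right_comm,
          ← ENNReal.ofReal_mul' (by positivity), ← mul_assoc, ← density_half_pow,
          ← ENNReal.ofReal_ofNat, ← ENNReal.ofReal_mul (by positivity)]
        congr 2
        ring
    _ ≤ _ := by
        gcongr 2 * ?_
        refine setLIntegral_mono' measurableSet_Ioc fun t ht => ?_
        gcongr
        · exact density_antitone hθ hr hlam hδ (lt_trans (by positivity) ht.1) ht.2
        · exact hW ht.1.le

/-! ### Fourier coefficients of differences -/

/-- The exponential `x ↦ e^(inx)`. -/
def expFun (n : ℤ) (x : ℝ) : ℂ := Complex.exp (((n : ℝ) * x : ℝ) * Complex.I)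

lemma norm_expFun (n : ℤ) (x : ℝ) : ‖expFun n x‖ = 1 := Complex.norm_exp_ofReal_mul_I _

lemma expFun_add (n : ℤ) (x y : ℝ) : expFun n (x + y) = expFun n x * expFun n y := by
  unfold expFun
  rw [← Complex.exp_add]; push_cast; ring_nf

lemma expFun_mul (n m : ℤ) (x : ℝ) : expFun n x * expFun m x = expFun (n + m) x := by
  unfold expFun
  rw [← Complex.exp_add]; push_cast; ring_nf

lemma expFun_mul_neg (n : ℤ) (x : ℝ) : expFun n x * expFun n (-x) = 1 := by
  rw [← expFun_add]; simp [expFun]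

lemma continuous_expFun (n : ℤ) : Continuous (expFun n) := by
  unfold expFun; fun_prop

lemma expFun_periodic (n : ℤ) : Function.Periodic (expFun n) (2 * Real.pi) := by
  intro x
  rw [expFun_add]
  have : expFun n (2 * Real.pi) = 1 := by
    unfold expFun
    rw [← Complex.exp_int_mul_two_pi_mul_I n]; push_cast; ring_nf
  rw [this, mul_one]

lemma expFun_eq (n : ℤ) (x : ℝ) :
    expFun n x = (Real.cos (n * x) : ℂ) + (Real.sin (n * x) : ℂ) * Complex.I := by
  unfold expFun
  rw [Complex.exp_mul_I, ← Complex.ofReal_cos, ← Complex.ofReal_sin]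

/-- The integral of `f x e^(inx)` over a period. -/
def expCoeff (f : ℝ → ℝ) (n : ℤ) : ℂ := ∫ x in (0 : ℝ)..(2 * Real.pi), (f x : ℂ) * expFun n x

lemma intervalIntegrable_ofReal {f : ℝ → ℝ} {a b : ℝ} (hf : IntervalIntegrable f volume a b) :
    IntervalIntegrable (fun x => (f x : ℂ)) volume a b :=
  ⟨hf.1.ofReal, hf.2.ofReal⟩

lemma intervalIntegrable_mul_expFun {f : ℝ → ℝ} {a b : ℝ} (hf : IntervalIntegrable f volume a b)
    (n : ℤ) : IntervalIntegrable (fun x => (f x : ℂ) * expFun n x) volume a b :=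
  IntervalIntegrable.mul_continuousOn (intervalIntegrable_ofReal hf) (continuous_expFun n).continuousOn

lemma intervalIntegrable_comp_add {f : ℝ → ℝ} (hper : Function.Periodic f (2 * Real.pi))
    (hf : IntervalIntegrable f volume 0 (2 * Real.pi)) (h : ℝ) :
    IntervalIntegrable (fun x => f (x + h)) volume 0 (2 * Real.pi) := by
  rw [IntervalIntegrable.comp_add_right_iff]
  exact hper.intervalIntegrable₀ Real.two_pi_pos.ne' hf _ _

lemma intervalIntegrable_fwdDiff {f : ℝ → ℝ} (hper : Function.Periodic f (2 * Real.pi))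
    (hf : IntervalIntegrable f volume 0 (2 * Real.pi)) (h : ℝ) :
    IntervalIntegrable (fwdDiff h f) volume 0 (2 * Real.pi) :=
  (intervalIntegrable_comp_add hper hf h).sub hf

lemma periodic_fwdDiff {f : ℝ → ℝ} {T : ℝ} (hper : Function.Periodic f T) (h : ℝ) :
    Function.Periodic (fwdDiff h f) T := by
  intro x
  simp only [fwdDiff]
  rw [add_right_comm, hper, hper]

lemma expCoeff_comp_add {f : ℝ → ℝ} (hper : Function.Periodic f (2 * Real.pi)) (h : ℝ) (n : ℤ) :
    expCoeff (fun x => f (x + h)) n = expFun n (-h) * expCoeff f n := by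
  unfold expCoeff
  have e : ∀ x, (f (x + h) : ℂ) * expFun n x
      = expFun n (-h) * ((f (x + h) : ℂ) * expFun n (x + h)) := fun x => by
    rw [expFun_add, mul_left_comm, mul_left_comm (expFun n (-h)), mul_comm (expFun n (-h)),
      expFun_mul_neg, mul_one]
  simp_rw [e]
  rw [intervalIntegral.integral_const_mul,
    intervalIntegral.integral_comp_add_right (fun x => (f x : ℂ) * expFun n x)]
  rw [zero_add]
  congr 1
  have hP : Function.Periodic (fun x => (f x : ℂ) * expFun n x) (2 * Real.pi) := fun x => by
    simp only [hper x, expFun_periodic n x]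
  have := hP.intervalIntegral_add_eq (0 + h) 0
  rwa [zero_add, zero_add, add_comm h] at this

lemma expCoeff_sub {f g : ℝ → ℝ} (hf : IntervalIntegrable f volume 0 (2 * Real.pi))
    (hg : IntervalIntegrable g volume 0 (2 * Real.pi)) (n : ℤ) :
    expCoeff (fun x => f x - g x) n = expCoeff f n - expCoeff g n := by
  unfold expCoeff
  rw [← intervalIntegral.integral_sub (intervalIntegrable_mul_expFun hf n)
    (intervalIntegrable_mul_expFun hg n)]
  congr 1 with x
  push_cast; ring

lemma expCoeff_fwdDiff {f : ℝ → ℝ} (hper : Function.Periodic f (2 * Real.pi))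
    (hf : IntervalIntegrable f volume 0 (2 * Real.pi)) (h : ℝ) (n : ℤ) :
    expCoeff (fwdDiff h f) n = (expFun n (-h) - 1) * expCoeff f n := by
  have := expCoeff_sub (intervalIntegrable_comp_add hper hf h) hf n
  rw [sub_mul, one_mul, ← expCoeff_comp_add hper, ← this]
  rfl

lemma fwdDiff_iterate_props {f : ℝ → ℝ} (hper : Function.Periodic f (2 * Real.pi))
    (hf : IntervalIntegrable f volume 0 (2 * Real.pi)) (h : ℝ) (n : ℤ) (k : ℕ) :
    Function.Periodic ((fwdDiff h)^[k] f) (2 * Real.pi) ∧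
      IntervalIntegrable ((fwdDiff h)^[k] f) volume 0 (2 * Real.pi) ∧
      expCoeff ((fwdDiff h)^[k] f) n = (expFun n (-h) - 1) ^ k * expCoeff f n := by
  induction k with
  | zero => simpa using ⟨hper, hf⟩
  | succ k ih =>
    obtain ⟨h1, h2, h3⟩ := ih
    rw [Function.iterate_succ_apply']
    refine ⟨periodic_fwdDiff h1 h, intervalIntegrable_fwdDiff h1 h2 h, ?_⟩
    rw [expCoeff_fwdDiff h1 h2, h3, pow_succ']
    ring

/-! ### Coefficients bounded by the modulus of smoothness -/

lemma enorm_expCoeff_le {p : ℝ≥0∞} (hp : 1 ≤ p) {f : ℝ → ℝ}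
    (hf : IntervalIntegrable f volume 0 (2 * Real.pi)) (n : ℤ) :
    ‖expCoeff f n‖ₑ ≤ periodNorm p f * ENNReal.ofReal (2 * Real.pi) ^ (1 - 1 / p.toReal) := by
  have hm : AEStronglyMeasurable f (volume.restrict (Set.Ioc 0 (2 * Real.pi))) :=
    ((intervalIntegrable_iff_integrableOn_Ioc_of_le Real.two_pi_pos.le).1 hf).aestronglyMeasurable
  have h1 := eLpNorm_le_eLpNorm_mul_rpow_measure_univ hp hm
  unfold expCoeff
  rw [intervalIntegral.integral_of_le Real.two_pi_pos.le]
  calc _ ≤ ∫⁻ x in Set.Ioc 0 (2 * Real.pi), ‖(f x : ℂ) * expFun n x‖ₑ :=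
        enorm_integral_le_lintegral_enorm _
    _ = eLpNorm f 1 (volume.restrict (Set.Ioc 0 (2 * Real.pi))) := by
        rw [eLpNorm_one_eq_lintegral_enorm]
        congr 1 with x
        rw [enorm_mul, ← ofReal_norm (expFun n x), norm_expFun, ← ofReal_norm,
          ← ofReal_norm]
        simp
    _ ≤ _ := by
        refine h1.trans_eq ?_
        simp [periodNorm]

lemma IsPeriodicLp.intervalIntegrable {p : ℝ≥0∞} (hp : 1 ≤ p) {f : ℝ → ℝ}
    (hf : IsPeriodicLp p f) : IntervalIntegrable f volume 0 (2 * Real.pi) :=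
  (intervalIntegrable_iff_integrableOn_Ioc_of_le Real.two_pi_pos.le).2 (hf.2.integrable hp)

lemma HasCosineSeries.expCoeff_eq {f : ℝ → ℝ} {c : ℕ → ℝ} (hfc : HasCosineSeries f c)
    (hf : IntervalIntegrable f volume 0 (2 * Real.pi)) (n : ℤ) :
    expCoeff f n = if n = 0 then 0 else ((Real.pi * c n.natAbs : ℝ) : ℂ) := by
  have hcos : IntervalIntegrable (fun x => f x * Real.cos (n * x)) volume 0 (2 * Real.pi) :=
    hf.mul_continuousOn (by fun_prop)
  have hsin : IntervalIntegrable (fun x => f x * Real.sin (n * x)) volume 0 (2 * Real.pi) :=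
    hf.mul_continuousOn (by fun_prop)
  have h1 : expCoeff f n = ((∫ x in (0 : ℝ)..(2 * Real.pi), f x * Real.cos (n * x) : ℝ) : ℂ)
      + ((∫ x in (0 : ℝ)..(2 * Real.pi), f x * Real.sin (n * x) : ℝ) : ℂ) * Complex.I := by
    unfold expCoeff
    rw [← intervalIntegral.integral_ofReal, ← intervalIntegral.integral_ofReal,
      ← intervalIntegral.integral_mul_const,
      ← intervalIntegral.integral_add (intervalIntegrable_ofReal hcos)
        ((intervalIntegrable_ofReal hsin).mul_const _)]
    congr 1 with x
    rw [expFun_eq]; push_cast; ring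
  split_ifs with hn
  · subst hn
    rw [h1]
    simp [hfc.1]
  · have hpos : 1 ≤ n.natAbs := Int.natAbs_pos.2 hn
    obtain ⟨h2, h3⟩ := hfc.2 n.natAbs hpos
    have hpi := Real.pi_ne_zero
    have h2' : ∫ x in (0 : ℝ)..(2 * Real.pi), f x * Real.cos (n.natAbs * x)
        = Real.pi * c n.natAbs := by rw [← h2]; field_simp
    have h3' : ∫ x in (0 : ℝ)..(2 * Real.pi), f x * Real.sin (n.natAbs * x) = 0 := by
      simpa [hpi] using h3
    rw [h1, ← h2']
    have hcast : ((n.natAbs : ℕ) : ℝ) = |(n : ℝ)| := by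
      rw [Nat.cast_natAbs, Int.cast_abs]
    rw [hcast] at h3' ⊢
    rcases abs_choice (n : ℝ) with h | h
    · rw [h] at h3' ⊢
      simp [h3']
    · rw [h] at h3' ⊢
      simp only [neg_mul, Real.sin_neg, mul_neg, intervalIntegral.integral_neg,
        neg_eq_zero, Real.cos_neg] at h3' ⊢
      simp [h3']

/-- The coefficients of `f` are controlled by its modulus of smoothness. -/
lemma exists_coeff_le_modulus {p : ℝ≥0∞} (hp : 1 ≤ p) (k : ℕ) {f : ℝ → ℝ} (hf : IsPeriodicLp p f)
    {c a : ℕ → ℝ} (hfc : HasCosineSeries f c) (hca : IsLacunary c a) :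
    ∃ C : ℝ≥0∞, C ≠ ∞ ∧
      ∀ n, ENNReal.ofReal (a n) ≤ C * modulus p k f ((1 / 2) ^ (n + 1)) := by
  have hint := hf.intervalIntegrable hp
  -- The multiplier of one difference at frequency `2^n` with step `2^(-n-1)`: their product is
  -- `1/2` for every `n`, and `sin (1/2) ≠ 0` gives `z ≠ 0`.
  set z : ℂ := Complex.exp (((-(1 / 2) : ℝ)) * Complex.I) - 1 with hz
  have hz0 : z ≠ 0 := by
    intro h0
    have := congrArg Complex.im h0
    rw [hz, Complex.sub_im, Complex.exp_ofReal_mul_I_im] at this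
    have h2 : Real.sin (1 / 2) = 0 := by simpa [Real.sin_neg] using this
    exact (Real.sin_pos_of_pos_of_lt_pi (by norm_num)
      (by linarith [Real.pi_gt_three])).ne' h2
  set L : ℝ≥0∞ := ENNReal.ofReal (2 * Real.pi) ^ (1 - 1 / p.toReal) with hL
  have hLtop : L ≠ ∞ := ENNReal.rpow_ne_top_of_ne_zero (by simp [Real.pi_pos]) ENNReal.ofReal_ne_top
  refine ⟨L / (ENNReal.ofReal (‖z‖ ^ k * Real.pi)), ENNReal.div_ne_top hLtop ?_, fun n => ?_⟩
  · have : 0 < ‖z‖ := norm_pos_iff.2 hz0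
    simp only [ne_eq, ENNReal.ofReal_eq_zero, not_le]
    have := Real.pi_pos
    positivity
  have hzk : 0 < ‖z‖ ^ k * Real.pi := by
    have : 0 < ‖z‖ := norm_pos_iff.2 hz0
    have := Real.pi_pos
    positivity
  set h : ℝ := (1 / 2) ^ (n + 1) with hh
  obtain ⟨-, h2, h3⟩ := fwdDiff_iterate_props hf.1 hint h (2 ^ n : ℤ) k
  have h4 : expFun (2 ^ n : ℤ) (-h) - 1 = z := by
    rw [hz, expFun]
    have : ((2 ^ n : ℤ) : ℝ) * -h = -(1 / 2) := by
      rw [hh, pow_succ]; push_cast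
      rw [mul_neg, ← mul_assoc, ← mul_pow]; norm_num
    rw [this]
  rw [h4, hfc.expCoeff_eq hint, if_neg (by positivity)] at h3
  have hc : c ((2 ^ n : ℤ).natAbs) = a n := by
    rw [Int.natAbs_pow]; exact (hca.1 n).2
  have h5 := enorm_expCoeff_le hp h2 (2 ^ n : ℤ)
  rw [h3, hc, ← ofReal_norm, norm_mul, norm_pow, Complex.norm_real, Real.norm_eq_abs,
    abs_of_nonneg (mul_nonneg Real.pi_pos.le (hca.1 n).1), ← mul_assoc,
    ENNReal.ofReal_mul hzk.le] at h5
  have h6 : periodNorm p ((fwdDiff h)^[k] f) ≤ modulus p k f h :=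
    le_iSup₂ (f := fun (h' : ℝ) (_ : |h'| ≤ h) => periodNorm p ((fwdDiff h')^[k] f)) h
      (abs_of_pos (by positivity)).le
  have hne : ENNReal.ofReal (‖z‖ ^ k * Real.pi) ≠ 0 := (ENNReal.ofReal_pos.2 hzk).ne'
  rw [mul_comm, ← mul_div_assoc, ENNReal.le_div_iff_mul_le (Or.inl hne)
    (Or.inl ENNReal.ofReal_ne_top), mul_comm]
  exact h5.trans (by gcongr)

/-! ### Uniqueness of Fourier coefficients -/

lemma integral_expFun (n : ℤ) :
    ∫ x in (0 : ℝ)..(2 * Real.pi), expFun n x = if n = 0 then ((2 * Real.pi : ℝ) : ℂ) else 0 := by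
  split_ifs with hn
  · simp [hn, expFun]
  · have hc : (n : ℂ) * Complex.I ≠ 0 := mul_ne_zero (by exact_mod_cast hn) Complex.I_ne_zero
    have e : ∀ x : ℝ, expFun n x = Complex.exp ((n : ℂ) * Complex.I * x) := fun x => by
      unfold expFun; push_cast; ring_nf
    have hper := expFun_periodic n 0
    rw [zero_add, e, e] at hper
    simp_rw [e]
    rw [integral_exp_mul_complex hc, hper, sub_self, zero_div]

/-- An integrable function all of whose Fourier coefficients vanish is zero almost everywhere. -/
lemma ae_eq_zero_of_expCoeff_eq_zero {d : ℝ → ℝ}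
    (hd : IntervalIntegrable d volume 0 (2 * Real.pi)) (h0 : ∀ n, expCoeff d n = 0) :
    ∀ᵐ x, x ∈ Set.Ioo 0 (2 * Real.pi) → d x = 0 := by
  have : Fact (0 < 2 * Real.pi) := ⟨Real.two_pi_pos⟩
  have hmul : ∀ γ : C(AddCircle (2 * Real.pi), ℂ),
      IntervalIntegrable (fun x : ℝ => (d x : ℂ) * γ x) volume 0 (2 * Real.pi) := fun γ =>
    (intervalIntegrable_ofReal hd).mul_continuousOn
      (γ.continuous.comp (AddCircle.continuous_mk' _)).continuousOn
  -- Pairing with `d` is a bounded functional on continuous functions on the circle. It kills the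
  -- exponentials, whose span is dense, hence it vanishes; bump functions supported in the open
  -- period then give `d = 0`.
  let Λ₀ : C(AddCircle (2 * Real.pi), ℂ) →ₗ[ℂ] ℂ :=
    { toFun := fun γ => ∫ x in (0 : ℝ)..(2 * Real.pi), (d x : ℂ) * γ x
      map_add' := fun γ γ' => by
        rw [← intervalIntegral.integral_add (hmul γ) (hmul γ')]
        simp only [ContinuousMap.add_apply, mul_add]
      map_smul' := fun z γ => by
        simp only [ContinuousMap.smul_apply, smul_eq_mul, RingHom.id_apply, mul_left_comm _ z]
        rw [intervalIntegral.integral_const_mul] }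
  let Λ : C(AddCircle (2 * Real.pi), ℂ) →L[ℂ] ℂ :=
    Λ₀.mkContinuous (∫ x in (0 : ℝ)..(2 * Real.pi), ‖d x‖) fun γ => by
      calc _ ≤ ∫ x in (0 : ℝ)..(2 * Real.pi), ‖(d x : ℂ) * γ x‖ :=
            intervalIntegral.norm_integral_le_integral_norm Real.two_pi_pos.le
        _ ≤ ∫ x in (0 : ℝ)..(2 * Real.pi), ‖d x‖ * ‖γ‖ := by
            refine intervalIntegral.integral_mono_on Real.two_pi_pos.le (hmul γ).norm
              (hd.norm.mul_const _) fun x _ => ?_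
            rw [norm_mul, Complex.norm_real]
            gcongr
            exact γ.norm_coe_le_norm _
        _ = _ := intervalIntegral.integral_mul_const _ _
  have hspan : Submodule.span ℂ (Set.range (@fourier (2 * Real.pi))) ≤ Λ.ker := by
    rw [Submodule.span_le]
    rintro _ ⟨n, rfl⟩
    change ∫ x in (0 : ℝ)..(2 * Real.pi), (d x : ℂ) * fourier n (x : AddCircle (2 * Real.pi)) = 0
    rw [← h0 n, expCoeff]
    congr 1 with x
    rw [fourier_coe_apply, expFun]
    congr 2
    have := Real.pi_ne_zero
    push_cast
    field_simp
  have hall : ∀ γ, Λ γ = 0 := fun γ => by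
    have h1 := Submodule.topologicalClosure_minimal _ hspan Λ.isClosed_ker
    rw [span_fourier_closure_eq_top] at h1
    exact h1 (Submodule.mem_top (x := γ))
  refine isOpen_Ioo.ae_eq_zero_of_integral_contDiff_smul_eq_zero ?_ fun g hg _ hsupp => ?_
  · exact (((intervalIntegrable_iff_integrableOn_Ioc_of_le Real.two_pi_pos.le).1 hd).mono_set
      Set.Ioo_subset_Ioc_self).locallyIntegrableOn
  · have hz : ∀ x, x ∉ Set.Ioo 0 (2 * Real.pi) → g x = 0 := fun x hx =>
      image_eq_zero_of_notMem_tsupport fun h => hx (hsupp h)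
    have hcont : Continuous (AddCircle.liftIco (2 * Real.pi) 0 fun x => (g x : ℂ)) := by
      refine AddCircle.liftIco_zero_continuous ?_ ?_
      · rw [hz 0 (by simp), hz (2 * Real.pi) (by simp)]
      · exact (Complex.continuous_ofReal.comp hg.continuous).continuousOn
    have h1 := hall ⟨_, hcont⟩
    change ∫ x in (0 : ℝ)..(2 * Real.pi), (d x : ℂ) *
      AddCircle.liftIco (2 * Real.pi) 0 (fun x => (g x : ℂ)) x = 0 at h1
    have h2 : ∫ x in (0 : ℝ)..(2 * Real.pi), (d x : ℂ) *
        AddCircle.liftIco (2 * Real.pi) 0 (fun x => (g x : ℂ)) x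
        = ∫ x in (0 : ℝ)..(2 * Real.pi), ((g x * d x : ℝ) : ℂ) := by
      refine intervalIntegral.integral_congr_ae ?_
      have hne : ∀ᵐ x : ℝ, x ≠ 2 * Real.pi := by simp [ae_iff]
      filter_upwards [hne] with x hx hmem
      rw [Set.uIoc_of_le Real.two_pi_pos.le] at hmem
      rw [AddCircle.liftIco_zero_coe_apply ⟨hmem.1.le, lt_of_le_of_ne hmem.2 hx⟩]
      push_cast; ring
    rw [h2, intervalIntegral.integral_ofReal, Complex.ofReal_eq_zero,
      intervalIntegral.integral_of_le Real.two_pi_pos.le] at h1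
    rw [← h1]
    refine (setIntegral_eq_integral_of_forall_compl_eq_zero fun x hx => ?_).symm
    rw [hz x fun h => hx (Set.Ioo_subset_Ioc_self h), zero_smul]

/-- Countably many translates of the period cover the line. The whole line is needed because
differences evaluate `f` outside one period. -/
lemma ae_eq_zero_of_periodic {d : ℝ → ℝ} (hper : Function.Periodic d (2 * Real.pi))
    (h : ∀ᵐ x, x ∈ Set.Ioo 0 (2 * Real.pi) → d x = 0) : ∀ᵐ x, d x = 0 := by
  have hne : ∀ᵐ x : ℝ, x ≠ 0 := by simp [ae_iff]
  have h1 : ∀ᵐ x, x ∈ Set.Ico 0 (2 * Real.pi) → d x = 0 := by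
    filter_upwards [h, hne] with x hx hx0 hmem
    exact hx ⟨lt_of_le_of_ne hmem.1 hx0.symm, hmem.2⟩
  have h2 : ∀ j : ℤ, ∀ᵐ x : ℝ, x + j * (2 * Real.pi) ∈ Set.Ico 0 (2 * Real.pi) →
      d (x + j * (2 * Real.pi)) = 0 := fun j =>
    (measurePreserving_add_right volume ((j : ℝ) * (2 * Real.pi))).quasiMeasurePreserving.ae h1
  filter_upwards [ae_all_iff.2 h2] with x hx
  obtain ⟨j, hj, -⟩ := existsUnique_add_zsmul_mem_Ico Real.two_pi_pos x 0
  rw [zero_add, zsmul_eq_mul] at hj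
  have := hx j hj
  rwa [hper.int_mul j x] at this

/-! ### Absolutely convergent lacunary series and the upper bound for the modulus -/

/-- The lacunary series `∑ Re (b_μ e^(i 2^μ x))`. -/
def lacunarySeries (b : ℕ → ℂ) (x : ℝ) : ℝ := ∑' m : ℕ, (b m * expFun (2 ^ m) x).re

lemma abs_re_mul_expFun_le (z : ℂ) (n : ℤ) (x : ℝ) : |(z * expFun n x).re| ≤ ‖z‖ := by
  refine (Complex.abs_re_le_norm _).trans ?_
  rw [norm_mul, norm_expFun, mul_one]

lemma summable_lacunary {b : ℕ → ℂ} (hb : Summable fun m => ‖b m‖) (x : ℝ) :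
    Summable fun m : ℕ => (b m * expFun (2 ^ m) x).re :=
  Summable.of_norm_bounded hb fun _ => abs_re_mul_expFun_le _ _ _

lemma abs_lacunarySeries_le {b : ℕ → ℂ} (hb : Summable fun m => ‖b m‖) (x : ℝ) :
    |lacunarySeries b x| ≤ ∑' m, ‖b m‖ :=
  tsum_of_norm_bounded (f := fun m : ℕ => (b m * expFun (2 ^ m) x).re) hb.hasSum
    fun _ => abs_re_mul_expFun_le _ _ _

lemma continuous_lacunarySeries {b : ℕ → ℂ} (hb : Summable fun m => ‖b m‖) :
    Continuous (lacunarySeries b) :=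
  continuous_tsum (fun _ => Complex.continuous_re.comp
    (continuous_const.mul (continuous_expFun _))) hb fun _ _ => abs_re_mul_expFun_le _ _ _

lemma lacunarySeries_periodic (b : ℕ → ℂ) :
    Function.Periodic (lacunarySeries b) (2 * Real.pi) := fun x => by
  unfold lacunarySeries
  simp_rw [fun m : ℕ => expFun_periodic (2 ^ m) x]

lemma norm_expFun_sub_one_le_two (n : ℤ) (x : ℝ) : ‖expFun n x - 1‖ ≤ 2 := by
  refine (norm_sub_le _ _).trans ?_
  rw [norm_expFun, norm_one]; norm_num

lemma norm_expFun_sub_one_le (n : ℤ) (x : ℝ) : ‖expFun n x - 1‖ ≤ |n * x| := by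
  unfold expFun
  rw [mul_comm]
  exact Real.norm_exp_I_mul_ofReal_sub_one_le

lemma summable_mul_sub_one {b : ℕ → ℂ} (hb : Summable fun m => ‖b m‖) (h : ℝ) :
    Summable fun m : ℕ => ‖b m * (expFun (2 ^ m) h - 1)‖ := by
  refine Summable.of_nonneg_of_le (fun _ => norm_nonneg _) (fun m => ?_) (hb.mul_right 2)
  rw [norm_mul]
  gcongr
  exact norm_expFun_sub_one_le_two _ _

/-- Complex coefficients make the class of such series stable under differences. -/
lemma fwdDiff_lacunarySeries {b : ℕ → ℂ} (hb : Summable fun m => ‖b m‖) (h : ℝ) :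
    fwdDiff h (lacunarySeries b)
      = lacunarySeries fun m => b m * (expFun (2 ^ m) h - 1) := by
  funext x
  unfold fwdDiff lacunarySeries
  rw [← (summable_lacunary hb _).tsum_sub (summable_lacunary hb _)]
  refine tsum_congr fun m => ?_
  rw [expFun_add, ← Complex.sub_re]
  ring_nf

lemma fwdDiff_iterate_lacunarySeries {b : ℕ → ℂ} (hb : Summable fun m => ‖b m‖) (h : ℝ) (k : ℕ) :
    (Summable fun m : ℕ => ‖b m * (expFun (2 ^ m) h - 1) ^ k‖) ∧
    (fwdDiff h)^[k] (lacunarySeries b)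
      = lacunarySeries fun m => b m * (expFun (2 ^ m) h - 1) ^ k := by
  induction k with
  | zero => simpa using hb
  | succ k ih =>
    rw [Function.iterate_succ_apply', ih.2, fwdDiff_lacunarySeries ih.1]
    have := summable_mul_sub_one ih.1 h
    simp_rw [mul_assoc, ← pow_succ] at this ⊢
    exact ⟨this, trivial⟩

/-- The real part is the mean of the exponentials of frequency `±2^m`; as `2^m ≠ 0`, at most one of
them pairs with `n`. -/
lemma integral_re_mul_expFun (m : ℕ) (α : ℝ) (n : ℤ) :
    ∫ x in (0 : ℝ)..(2 * Real.pi), ((((α : ℂ) * expFun (2 ^ m) x).re : ℝ) : ℂ) * expFun n x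
      = if n.natAbs = 2 ^ m then ((Real.pi * α : ℝ) : ℂ) else 0 := by
  have e : ∀ x : ℝ, ((((α : ℂ) * expFun (2 ^ m) x).re : ℝ) : ℂ) * expFun n x
      = (α / 2 : ℂ) * expFun (2 ^ m + n) x + (α / 2 : ℂ) * expFun (-2 ^ m + n) x := by
    intro x
    rw [← expFun_mul, ← expFun_mul, ← mul_assoc, ← mul_assoc, ← add_mul, expFun_eq (2 ^ m),
      expFun_eq (-2 ^ m)]
    congr 1
    rw [← mul_add, Complex.re_ofReal_mul]
    have : ((((-2 ^ m : ℤ)) : ℝ) * x) = -(((2 ^ m : ℤ) : ℝ) * x) := by push_cast; ring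
    rw [this, Real.cos_neg, Real.sin_neg, Complex.add_re, Complex.ofReal_re, Complex.re_ofReal_mul,
      Complex.I_re]
    push_cast; ring
  simp_rw [e]
  rw [intervalIntegral.integral_add
    (((continuous_expFun _).intervalIntegrable _ _).const_mul _)
    (((continuous_expFun _).intervalIntegrable _ _).const_mul _),
    intervalIntegral.integral_const_mul, intervalIntegral.integral_const_mul,
    integral_expFun, integral_expFun]
  have h2 : (0 : ℤ) < 2 ^ m := by positivity
  have hcast : ((2 ^ m : ℕ) : ℤ) = 2 ^ m := by push_cast; rfl
  by_cases hn : n.natAbs = 2 ^ m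
  · rw [if_pos hn]
    rcases Int.natAbs_eq n with h | h
    · rw [if_neg (by omega), if_pos (by omega)]
      push_cast; ring
    · rw [if_pos (by omega), if_neg (by omega)]
      push_cast; ring
  · rw [if_neg hn, if_neg (by omega), if_neg (by omega)]
    simp

lemma expCoeff_lacunarySeries {a : ℕ → ℝ} (ha : Summable fun m => ‖(a m : ℂ)‖) (n : ℤ) :
    expCoeff (lacunarySeries fun m => (a m : ℂ)) n
      = ∑' m : ℕ, if n.natAbs = 2 ^ m then ((Real.pi * a m : ℝ) : ℂ) else 0 := by
  simp_rw [← integral_re_mul_expFun]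
  unfold expCoeff
  refine (HasSum.tsum_eq ?_).symm
  refine intervalIntegral.hasSum_integral_of_dominated_convergence
    (fun m _ => ‖(a m : ℂ)‖) (fun m => ?_) (fun m => ?_) ?_ ?_ ?_
  · refine Continuous.aestronglyMeasurable ?_
    exact (Complex.continuous_ofReal.comp (Complex.continuous_re.comp
      (continuous_const.mul (continuous_expFun _)))).mul (continuous_expFun n)
  · refine Filter.Eventually.of_forall fun x _ => ?_
    rw [norm_mul, norm_expFun, mul_one, Complex.norm_real]
    exact abs_re_mul_expFun_le _ _ _
  · exact Filter.Eventually.of_forall fun x _ => ha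
  · exact intervalIntegrable_const
  · refine Filter.Eventually.of_forall fun x _ => ?_
    refine HasSum.mul_right _ ?_
    exact Complex.hasSum_ofReal.2 (summable_lacunary ha x).hasSum

lemma ae_eq_lacunarySeries {p : ℝ≥0∞} (hp : 1 ≤ p) {f : ℝ → ℝ} (hf : IsPeriodicLp p f)
    {c a : ℕ → ℝ} (hfc : HasCosineSeries f c) (hca : IsLacunary c a)
    (ha : Summable fun m => ‖(a m : ℂ)‖) :
    f =ᵐ[volume] lacunarySeries fun m => (a m : ℂ) := by
  have hint := hf.intervalIntegrable hp
  have hG := (continuous_lacunarySeries ha).intervalIntegrable (μ := volume) 0 (2 * Real.pi)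
  have hcoef : ∀ n, expCoeff (fun x => f x - lacunarySeries (fun m => (a m : ℂ)) x) n = 0 := by
    intro n
    rw [expCoeff_sub hint hG, hfc.expCoeff_eq hint, expCoeff_lacunarySeries ha, sub_eq_zero]
    split_ifs with hn
    · simp [hn, (Nat.two_pow_pos _).ne]
    · by_cases hpow : ∃ m, n.natAbs = 2 ^ m
      · obtain ⟨m, hm⟩ := hpow
        rw [tsum_eq_single m, if_pos hm, hm, (hca.1 m).2]
        intro m' hm'
        refine if_neg fun h => hm' ?_
        exact Nat.pow_right_injective le_rfl (h.symm.trans hm)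
      · rw [hca.2 _ (Int.natAbs_pos.2 hn) (not_exists.1 hpow)]
        simp [not_exists.1 hpow]
  have h1 := ae_eq_zero_of_periodic (d := fun x => f x - lacunarySeries (fun m => (a m : ℂ)) x)
    (fun x => by simp only [hf.1 x, lacunarySeries_periodic _ x])
    (ae_eq_zero_of_expCoeff_eq_zero (hint.sub hG) hcoef)
  filter_upwards [h1] with x hx
  exact sub_eq_zero.1 hx

lemma fwdDiff_iterate_congr_ae {f g : ℝ → ℝ} (h : f =ᵐ[volume] g) (t : ℝ) (k : ℕ) :
    (fwdDiff t)^[k] f =ᵐ[volume] (fwdDiff t)^[k] g := by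
  induction k with
  | zero => exact h
  | succ k ih =>
    rw [Function.iterate_succ_apply', Function.iterate_succ_apply']
    have h1 := (measurePreserving_add_right volume t).quasiMeasurePreserving.ae ih
    filter_upwards [ih, h1] with x hx hx'
    simp only [fwdDiff, hx, hx']

/-- This combines `|e^(iy) - 1| ≤ 2`, used for `m ≥ n`, with `|e^(iy) - 1| ≤ |y|`, used for `m ≤ n`.
-/
lemma norm_expFun_sub_one_pow_le {n : ℕ} {h : ℝ} (hh : |h| ≤ (1 / 2) ^ n) (k m : ℕ) :
    ‖expFun (2 ^ m) h - 1‖ ^ k ≤ 2 ^ k * (2 : ℝ) ^ (-((k : ℝ) * (n - m : ℕ))) := by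
  have h1 : ‖expFun (2 ^ m) h - 1‖ ≤ 2 * (2 : ℝ) ^ (-((n - m : ℕ) : ℝ)) := by
    rcases le_total n m with hnm | hnm
    · rw [Nat.sub_eq_zero_of_le hnm]
      simpa using norm_expFun_sub_one_le_two (2 ^ m) h
    · obtain ⟨d, rfl⟩ := Nat.exists_eq_add_of_le hnm
      rw [Nat.add_sub_cancel_left, Real.rpow_neg two_pos.le, Real.rpow_natCast]
      calc _ ≤ |((2 ^ m : ℤ) : ℝ) * h| := norm_expFun_sub_one_le _ _
        _ = 2 ^ m * |h| := by rw [abs_mul]; simp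
        _ ≤ 2 ^ m * (1 / 2) ^ (m + d) := by gcongr
        _ = ((2 : ℝ) ^ d)⁻¹ := by
            rw [pow_add, ← mul_assoc, ← mul_pow, one_div, inv_pow]; norm_num
        _ ≤ _ := by
            have : 0 ≤ ((2 : ℝ) ^ d)⁻¹ := by positivity
            linarith
  calc _ ≤ (2 * (2 : ℝ) ^ (-((n - m : ℕ) : ℝ))) ^ k := by gcongr
    _ = _ := by
        rw [mul_pow, ← Real.rpow_natCast ((2 : ℝ) ^ (-((n - m : ℕ) : ℝ))),
          ← Real.rpow_mul two_pos.le]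
        ring_nf

/-- The modulus of smoothness of a lacunary series with summable coefficients is controlled by
its coefficients. -/
lemma modulus_le_tsum {p : ℝ≥0∞} (hp : 1 ≤ p) (k : ℕ) {f : ℝ → ℝ} (hf : IsPeriodicLp p f)
    {c a : ℕ → ℝ} (hfc : HasCosineSeries f c) (hca : IsLacunary c a)
    (ha : ∑' m, ENNReal.ofReal (a m) ≠ ∞) (n : ℕ) :
    modulus p k f ((1 / 2) ^ n) ≤ ENNReal.ofReal (2 * Real.pi) ^ p.toReal⁻¹ * 2 ^ k *
      ∑' m, ENNReal.ofReal (a m) * ENNReal.ofReal ((2 : ℝ) ^ (-((k : ℝ) * (n - m : ℕ)))) := by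
  have hnorm : ∀ m, ‖(a m : ℂ)‖ = a m := fun m => by
    rw [Complex.norm_real, Real.norm_of_nonneg (hca.1 m).1]
  have ha' : Summable fun m => ‖(a m : ℂ)‖ := by
    simp_rw [hnorm]
    have := ENNReal.summable_toReal ha
    simpa [ENNReal.toReal_ofReal (hca.1 _).1] using this
  have hfae := ae_eq_lacunarySeries hp hf hfc hca ha'
  refine iSup₂_le fun h hh => ?_
  obtain ⟨hs, hd⟩ := fwdDiff_iterate_lacunarySeries ha' h k
  have hbound : ∀ᵐ x ∂(volume.restrict (Set.Ioc 0 (2 * Real.pi))), ‖(fwdDiff h)^[k] f x‖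
      ≤ ∑' m, ‖(a m : ℂ) * (expFun (2 ^ m) h - 1) ^ k‖ := by
    refine ae_restrict_of_ae ?_
    filter_upwards [fwdDiff_iterate_congr_ae hfae h k] with x hx
    rw [hx, hd]
    exact abs_lacunarySeries_le hs x
  refine (eLpNorm_le_of_ae_bound hbound).trans ?_
  rw [mul_assoc, Measure.restrict_apply_univ, Real.volume_Ioc, sub_zero,
    ENNReal.ofReal_tsum_of_nonneg (fun _ => norm_nonneg _) hs, ← ENNReal.tsum_mul_left (a := 2 ^ k)]
  gcongr with m
  rw [norm_mul, norm_pow, hnorm, ENNReal.ofReal_mul (hca.1 m).1, mul_left_comm]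
  gcongr
  have h2 : (2 : ℝ≥0∞) ^ k = ENNReal.ofReal (2 ^ k) := by
    rw [ENNReal.ofReal_pow two_pos.le, ENNReal.ofReal_ofNat]
  rw [h2, ← ENNReal.ofReal_mul (by positivity)]
  exact ENNReal.ofReal_le_ofReal (norm_expFun_sub_one_pow_le hh k m)

/-! ### Two-sided comparison of the integral with the weighted sum -/

lemma weightedSum_le_mul {θ r lam δ : ℝ} (hθ : 0 < θ) {A B : ℕ → ℝ≥0∞} {C : ℝ≥0∞}
    (h : ∀ n, A n ≤ C * B n) :
    weightedSum θ r lam A δ ≤ C ^ θ * weightedSum θ r lam B δ := by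
  unfold weightedSum
  rw [← ENNReal.tsum_mul_left]
  refine ENNReal.tsum_le_tsum fun n => ?_
  rw [mul_left_comm, ← ENNReal.mul_rpow_of_nonneg _ _ hθ.le]
  gcongr
  exact h n

/-- The `θ`-th power of the quantity that defines the class, as a single integral. -/
def besovPower (p : ℝ≥0∞) (θ r lam : ℝ) (k : ℕ) (f : ℝ → ℝ) (δ : ℝ) : ℝ≥0∞ :=
  ∫⁻ t in Set.Ioc (0 : ℝ) 1, ENNReal.ofReal (density θ r lam δ t) * modulus p k f t ^ θ

lemma exists_weightedSum_le_besovPower {p : ℝ≥0∞} (hp : 1 ≤ p) {θ r lam : ℝ} (hθ : 0 < θ)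
    (hr : 0 < r) (hlam : 0 < lam) (k : ℕ) {f : ℝ → ℝ} (hf : IsPeriodicLp p f)
    {c a : ℕ → ℝ} (hfc : HasCosineSeries f c) (hca : IsLacunary c a) :
    ∃ C : ℝ≥0∞, C ≠ ∞ ∧ ∀ δ : ℝ, 0 < δ →
      weightedSum θ r lam (fun n => ENNReal.ofReal (a n)) δ ≤ C * besovPower p θ r lam k f δ := by
  obtain ⟨C, hC, h⟩ := exists_coeff_le_modulus hp k hf hfc hca
  refine ⟨C ^ θ * 2, ENNReal.mul_ne_top (ENNReal.rpow_ne_top_of_nonneg hθ.le hC) (by simp),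
    fun δ hδ => ?_⟩
  refine (weightedSum_le_mul hθ h).trans ?_
  rw [mul_assoc]
  gcongr
  exact le_lintegral_density hθ hr hlam hδ (modulus_mono p k f)

lemma exists_besovPower_le_weightedSum {p : ℝ≥0∞} (hp : 1 ≤ p) {θ r lam : ℝ} (hθ : 0 < θ)
    (hr : 0 < r) (hlam : 0 < lam) {k : ℕ} (hk : r + lam < k) {f : ℝ → ℝ} (hf : IsPeriodicLp p f)
    {c a : ℕ → ℝ} (hfc : HasCosineSeries f c) (hca : IsLacunary c a) :
    ∃ C : ℝ≥0∞, C ≠ ∞ ∧ ∀ δ : ℝ, 0 < δ →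
      besovPower p θ r lam k f δ ≤ C * weightedSum θ r lam (fun n => ENNReal.ofReal (a n)) δ := by
  obtain ⟨H, hH, hardy⟩ := exists_hardy_le hθ hr hlam hk
  set K : ℝ≥0∞ := ENNReal.ofReal (2 * Real.pi) ^ p.toReal⁻¹ * 2 ^ k with hK
  have hKtop : K ≠ ∞ := ENNReal.mul_ne_top
    (ENNReal.rpow_ne_top_of_nonneg (by positivity) ENNReal.ofReal_ne_top) (by simp)
  set C : ℝ≥0∞ := ENNReal.ofReal ((2 : ℝ) ^ ((r + lam) * θ)) * (K ^ θ * H) with hC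
  have hCtop : C ≠ ∞ := ENNReal.mul_ne_top ENNReal.ofReal_ne_top
    (ENNReal.mul_ne_top (ENNReal.rpow_ne_top_of_nonneg hθ.le hKtop) hH)
  -- Adding `1` makes the constant nonzero, so the bound is trivial when the weighted sum is
  -- infinite.
  refine ⟨C + 1, ENNReal.add_ne_top.2 ⟨hCtop, by simp⟩, fun δ hδ => ?_⟩
  set A : ℕ → ℝ≥0∞ := fun n => ENNReal.ofReal (a n) with hA
  by_cases htop : weightedSum θ r lam A δ = ∞
  · rw [htop, ENNReal.mul_top (by simp)]
    exact le_top
  -- For `n = 0` the truncated exponent `0 - m` is zero, so the first term on the left of the Hardy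
  -- inequality is a positive multiple of `(∑ A m)^θ`.
  have hsum : ∑' m, A m ≠ ∞ := by
    have h1 := (ENNReal.le_tsum 0).trans (hardy δ hδ A)
    have h2 := ne_top_of_le_ne_top (ENNReal.mul_ne_top hH htop) h1
    intro hcon
    refine h2 ?_
    beta_reduce
    have h3 : ∑' m, A m * ENNReal.ofReal ((2 : ℝ) ^ (-((k : ℝ) * (0 - m : ℕ)))) = ∞ := by
      simpa using hcon
    rw [h3, ENNReal.top_rpow_of_pos hθ, ENNReal.mul_top]
    exact (ENNReal.ofReal_pos.2 (weight_pos hδ 0)).ne'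
  calc _ ≤ ENNReal.ofReal ((2 : ℝ) ^ ((r + lam) * θ)) *
        weightedSum θ r lam (fun n => modulus p k f ((1 / 2) ^ n)) δ :=
        lintegral_density_le hθ hr hlam hδ (modulus_mono p k f)
    _ ≤ ENNReal.ofReal ((2 : ℝ) ^ ((r + lam) * θ)) *
        (K ^ θ * (H * weightedSum θ r lam A δ)) := by
        gcongr
        refine (weightedSum_le_mul hθ (modulus_le_tsum hp k hf hfc hca hsum)).trans ?_
        gcongr
        exact hardy δ hδ A
    _ = C * weightedSum θ r lam A δ := by rw [hC]; ring
    _ ≤ _ := by gcongr; exact le_self_add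

/-! ### Normalising the constants, and transfer between scales -/

lemma exists_rpow_one_div_le_iff {ι : Type*} {s : Set ι} {X : ι → ℝ≥0∞} {ψ : ι → ℝ} {θ : ℝ}
    (hθ : 0 < θ) :
    (∃ C : ℝ, 0 < C ∧ ∀ i ∈ s, X i ^ (1 / θ) ≤ ENNReal.ofReal (C * ψ i)) ↔
      ∃ K : ℝ≥0∞, K ≠ ∞ ∧ ∀ i ∈ s, X i ≤ K * ENNReal.ofReal (ψ i) ^ θ := by
  simp_rw [one_div]
  constructor
  · rintro ⟨C, hC, h⟩
    refine ⟨ENNReal.ofReal C ^ θ, ENNReal.rpow_ne_top_of_nonneg hθ.le ENNReal.ofReal_ne_top,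
      fun i hi => ?_⟩
    rw [← ENNReal.mul_rpow_of_nonneg _ _ hθ.le, ← ENNReal.ofReal_mul hC.le]
    exact (ENNReal.rpow_inv_le_iff hθ).1 (h i hi)
  · rintro ⟨K, hK, h⟩
    have hK' : K ^ θ⁻¹ ≠ ∞ := ENNReal.rpow_ne_top_of_nonneg (by positivity) hK
    have hC : 0 < (K ^ θ⁻¹).toReal + 1 := by positivity
    refine ⟨(K ^ θ⁻¹).toReal + 1, hC, fun i hi => ?_⟩
    rw [ENNReal.rpow_inv_le_iff hθ, ENNReal.ofReal_mul hC.le,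
      ENNReal.mul_rpow_of_nonneg _ _ hθ.le]
    refine (h i hi).trans ?_
    gcongr
    rw [← ENNReal.rpow_inv_le_iff hθ]
    refine (ENNReal.ofReal_toReal hK').symm.le.trans (ENNReal.ofReal_le_ofReal ?_)
    linarith

lemma exists_le_ofReal_mul_rpow_iff {ι : Type*} {X : ι → ℝ≥0∞} {ψ : ι → ℝ} {θ : ℝ} (hθ : 0 < θ)
    (hψ : ∀ i, 0 ≤ ψ i) :
    (∃ C : ℝ, 0 < C ∧ ∀ i, X i ≤ ENNReal.ofReal (C * ψ i ^ θ)) ↔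
      ∃ K : ℝ≥0∞, K ≠ ∞ ∧ ∀ i, X i ≤ K * ENNReal.ofReal (ψ i) ^ θ := by
  have e : ∀ i, ∀ C : ℝ, 0 < C →
      ENNReal.ofReal (C * ψ i ^ θ) = ENNReal.ofReal C * ENNReal.ofReal (ψ i) ^ θ := fun i C hC => by
    rw [ENNReal.ofReal_mul hC.le, ENNReal.ofReal_rpow_of_nonneg (hψ i) hθ.le]
  constructor
  · rintro ⟨C, hC, h⟩
    exact ⟨ENNReal.ofReal C, ENNReal.ofReal_ne_top, fun i => (h i).trans_eq (e i C hC)⟩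
  · rintro ⟨K, hK, h⟩
    have hC : 0 < K.toReal + 1 := by positivity
    refine ⟨K.toReal + 1, hC, fun i => ?_⟩
    rw [e i _ hC]
    refine (h i).trans ?_
    gcongr
    refine (ENNReal.ofReal_toReal hK).symm.le.trans (ENNReal.ofReal_le_ofReal ?_)
    linarith

/-- The sign is assumed only inside `(0, 1)`; comparison with `1/2` extends it to the end point. -/
lemma IsMajorant.nonneg_one {φ : ℝ → ℝ} (hφ : IsMajorant φ) : 0 ≤ φ 1 := by
  obtain ⟨C, hC, h⟩ := hφ.almost_mono
  have h1 := h (1 / 2) 1 (by norm_num) (by norm_num) le_rfl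
  have h2 := hφ.nonneg (1 / 2) (by norm_num)
  exact nonneg_of_mul_nonneg_right (h2.trans h1) hC

lemma IsMajorant.nonneg_half_pow {φ : ℝ → ℝ} (hφ : IsMajorant φ) (n : ℕ) :
    0 ≤ φ (1 / (2 : ℝ) ^ n) := by
  rcases Nat.eq_zero_or_pos n with rfl | hn
  · simpa using hφ.nonneg_one
  · refine hφ.nonneg _ ⟨by positivity, ?_⟩
    rw [div_lt_one (by positivity)]
    exact one_lt_pow₀ one_lt_two hn.ne'

lemma classN_iff {p : ℝ≥0∞} (hp : 1 ≤ p) {θ r lam : ℝ} (hθ : 0 < θ)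
    (hr : 0 < r) (hlam : 0 < lam) {k : ℕ} (hk : r + lam < k) (φ : ℝ → ℝ) {f : ℝ → ℝ}
    (hf : IsPeriodicLp p f)
    {c a : ℕ → ℝ} (hfc : HasCosineSeries f c) (hca : IsLacunary c a) :
    f ∈ classN p θ r lam k φ ↔ ∃ K : ℝ≥0∞, K ≠ ∞ ∧ ∀ δ ∈ Set.Ioo (0 : ℝ) 1,
      weightedSum θ r lam (fun n => ENNReal.ofReal (a n)) δ ≤ K * ENNReal.ofReal (φ δ) ^ θ := by
  have h1 : f ∈ classN p θ r lam k φ ↔ ∃ C : ℝ, 0 < C ∧ ∀ δ ∈ Set.Ioo (0 : ℝ) 1,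
      besovPower p θ r lam k f δ ^ (1 / θ) ≤ ENNReal.ofReal (C * φ δ) := by
    refine (and_iff_right hf).trans (exists_congr fun C => and_congr_right fun _ =>
      forall₂_congr fun δ hδ => ?_)
    rw [besovIntegral_eq p hθ hlam k f hδ.1 hδ.2.le, besovPower]
  rw [h1, exists_rpow_one_div_le_iff hθ]
  constructor
  · rintro ⟨K, hK, h⟩
    obtain ⟨C, hC, hle⟩ := exists_weightedSum_le_besovPower hp hθ hr hlam k hf hfc hca
    refine ⟨C * K, ENNReal.mul_ne_top hC hK, fun δ hδ => (hle δ hδ.1).trans ?_⟩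
    rw [mul_assoc]
    gcongr
    exact h δ hδ
  · rintro ⟨K, hK, h⟩
    obtain ⟨C, hC, hle⟩ := exists_besovPower_le_weightedSum hp hθ hr hlam hk hf hfc hca
    refine ⟨C * K, ENNReal.mul_ne_top hC hK, fun δ hδ => (hle δ hδ.1).trans ?_⟩
    rw [mul_assoc]
    gcongr
    exact h δ hδ

lemma rpow_ofReal_le_mul {θ x y C : ℝ} (hθ : 0 < θ) (hC : 0 < C) (h : x ≤ C * y) :
    ENNReal.ofReal x ^ θ ≤ ENNReal.ofReal C ^ θ * ENNReal.ofReal y ^ θ := by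
  rw [← ENNReal.mul_rpow_of_nonneg _ _ hθ.le, ← ENNReal.ofReal_mul hC.le]
  gcongr

lemma weightedSum_bound_nat_of_Ioo {θ r lam : ℝ} (hθ : 0 < θ) (hlam : 0 < lam) {φ : ℝ → ℝ}
    (hφ : IsMajorant φ) {A : ℕ → ℝ≥0∞} {K : ℝ≥0∞} (hK : K ≠ ∞)
    (h : ∀ δ ∈ Set.Ioo (0 : ℝ) 1, weightedSum θ r lam A δ ≤ K * ENNReal.ofReal (φ δ) ^ θ) :
    ∃ K : ℝ≥0∞, K ≠ ∞ ∧ ∀ m : ℕ, 1 ≤ m →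
      weightedSum θ r lam A (1 / (m : ℝ)) ≤ K * ENNReal.ofReal (φ (1 / (m : ℝ))) ^ θ := by
  obtain ⟨C, hC, hmono⟩ := hφ.almost_mono
  set K₁ := ENNReal.ofReal ((2 : ℝ) ^ (lam * θ)) * (K * ENNReal.ofReal C ^ θ) with hK₁
  have hK₁top : K₁ ≠ ∞ := ENNReal.mul_ne_top ENNReal.ofReal_ne_top
    (ENNReal.mul_ne_top hK (ENNReal.rpow_ne_top_of_nonneg hθ.le ENNReal.ofReal_ne_top))
  refine ⟨K + K₁, ENNReal.add_ne_top.2 ⟨hK, hK₁top⟩, fun m hm => ?_⟩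
  -- `m = 1` gives `δ = 1`, outside the open interval. It is reached from `δ = 1/2`, by doubling of
  -- the weighted sum and `φ (1/2) ≤ C * φ 1`.
  rcases hm.eq_or_lt with rfl | hm
  · have e : (1 / ((1 : ℕ) : ℝ)) = 2 * (1 / 2) := by norm_num
    have e' : (2 * (1 / 2) : ℝ) = 1 := by norm_num
    rw [e]
    calc _ ≤ _ := weightedSum_two_mul_le hθ hlam A (by norm_num)
      _ ≤ ENNReal.ofReal ((2 : ℝ) ^ (lam * θ)) * (K * (ENNReal.ofReal C ^ θ *
          ENNReal.ofReal (φ 1) ^ θ)) := by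
          gcongr
          refine (h (1 / 2) (by norm_num)).trans ?_
          gcongr
          exact rpow_ofReal_le_mul hθ hC (hmono _ _ (by norm_num) (by norm_num) le_rfl)
      _ = K₁ * ENNReal.ofReal (φ 1) ^ θ := by rw [hK₁]; ring
      _ ≤ _ := by rw [e']; gcongr; exact le_add_self
  · have hm' : (1 : ℝ) < m := by exact_mod_cast hm
    refine (h (1 / (m : ℝ)) ⟨by positivity, (div_lt_one (by positivity)).2 hm'⟩).trans ?_
    gcongr
    exact le_self_add

/-- For `2^(-n-1) < δ ≤ 2^(-n)` the sum increases from `δ` to `2^(-n)`, while `φ(2^(-n)) ≤ D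
φ(2^(-n-1)) ≤ D C φ(δ)`. -/
lemma weightedSum_bound_Ioo_of_dyadic {θ r lam : ℝ} (hθ : 0 < θ) (hlam : 0 < lam) {φ : ℝ → ℝ}
    (hφ : IsMajorant φ) {A : ℕ → ℝ≥0∞} {K : ℝ≥0∞} (hK : K ≠ ∞)
    (h : ∀ n : ℕ, weightedSum θ r lam A (1 / (2 : ℝ) ^ n)
      ≤ K * ENNReal.ofReal (φ (1 / (2 : ℝ) ^ n)) ^ θ) :
    ∃ K : ℝ≥0∞, K ≠ ∞ ∧ ∀ δ ∈ Set.Ioo (0 : ℝ) 1,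
      weightedSum θ r lam A δ ≤ K * ENNReal.ofReal (φ δ) ^ θ := by
  obtain ⟨C, hC, hmono⟩ := hφ.almost_mono
  obtain ⟨D, hD, hdoub⟩ := hφ.doubling
  refine ⟨K * (ENNReal.ofReal D ^ θ * ENNReal.ofReal C ^ θ), ENNReal.mul_ne_top hK
    (ENNReal.mul_ne_top (ENNReal.rpow_ne_top_of_nonneg hθ.le ENNReal.ofReal_ne_top)
      (ENNReal.rpow_ne_top_of_nonneg hθ.le ENNReal.ofReal_ne_top)), fun δ hδ => ?_⟩
  obtain ⟨n, hn1, hn2⟩ := exists_nat_pow_near_of_lt_one hδ.1 hδ.2.le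
    (by norm_num : (0 : ℝ) < 1 / 2) (by norm_num)
  have e : (1 / (2 : ℝ) ^ n) = 2 * (1 / 2) ^ (n + 1) := by
    rw [pow_succ, one_div_pow]; ring
  have hle : (1 / 2 : ℝ) ^ (n + 1) ≤ 1 / 2 := by
    rw [pow_succ]
    exact mul_le_of_le_one_left (by norm_num) (pow_le_one₀ (by norm_num) (by norm_num))
  calc _ ≤ weightedSum θ r lam A (1 / (2 : ℝ) ^ n) :=
        weightedSum_mono hθ hlam A hδ.1 (by rwa [one_div_pow] at hn2)
    _ ≤ _ := h n
    _ ≤ K * (ENNReal.ofReal D ^ θ * (ENNReal.ofReal C ^ θ * ENNReal.ofReal (φ δ) ^ θ)) := by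
        gcongr
        rw [e]
        refine (rpow_ofReal_le_mul hθ hD (hdoub _ (by positivity) hle)).trans ?_
        gcongr
        exact rpow_ofReal_le_mul hθ hC (hmono _ _ (by positivity) hn1.le hδ.2.le)
    _ = _ := by ring

end NikolskiiBesov

end

theorem theorem3 (p : ℝ≥0∞) (hp : 1 ≤ p) (hp' : p ≠ ∞)
    (θ r lam : ℝ) (hθ : 0 < θ) (hr : 0 < r) (hlam : 0 < lam)
    (k : ℕ) (hk : r + lam < k)
    (φ : ℝ → ℝ) (hφ : NikolskiiBesov.IsMajorant φ)
    (f : ℝ → ℝ) (hf : NikolskiiBesov.IsPeriodicLp p f)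
    (c a : ℕ → ℝ) (hfc : NikolskiiBesov.HasCosineSeries f c) (hca : NikolskiiBesov.IsLacunary c a) :
    (f ∈ NikolskiiBesov.classN p θ r lam k φ ↔
      ∃ C : ℝ, 0 < C ∧ ∀ m : ℕ, 1 ≤ m →
        NikolskiiBesov.coeffSum θ r lam c m ^ (1 / θ) ≤ ENNReal.ofReal (C * φ (1 / (m : ℝ)))) ∧
    (f ∈ NikolskiiBesov.classN p θ r lam k φ ↔
      ∃ C : ℝ, 0 < C ∧ ∀ n : ℕ,
        NikolskiiBesov.dyadicSum θ r lam a n ≤ ENNReal.ofReal (C * φ (1 / (2 : ℝ) ^ n) ^ θ)) := by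
  open NikolskiiBesov in
  set A : ℕ → ℝ≥0∞ := fun n => ENNReal.ofReal (a n) with hA
  have hclass := classN_iff hp hθ hr hlam hk φ hf hfc hca
  have hcoeff := exists_rpow_one_div_le_iff (s := {m : ℕ | 1 ≤ m})
    (X := coeffSum θ r lam c) (ψ := fun m : ℕ => φ (1 / (m : ℝ))) hθ
  have hdyad := exists_le_ofReal_mul_rpow_iff (X := dyadicSum θ r lam a)
    (ψ := fun n : ℕ => φ (1 / (2 : ℝ) ^ n)) hθ hφ.nonneg_half_pow
  have toNat : f ∈ classN p θ r lam k φ → ∃ K : ℝ≥0∞, K ≠ ∞ ∧ ∀ m : ℕ, 1 ≤ m →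
      weightedSum θ r lam A (1 / (m : ℝ)) ≤ K * ENNReal.ofReal (φ (1 / (m : ℝ))) ^ θ := by
    intro h
    obtain ⟨K, hK, hb⟩ := hclass.1 h
    exact weightedSum_bound_nat_of_Ioo hθ hlam hφ hK hb
  have toDyadic : (∃ K : ℝ≥0∞, K ≠ ∞ ∧ ∀ m : ℕ, 1 ≤ m →
      weightedSum θ r lam A (1 / (m : ℝ)) ≤ K * ENNReal.ofReal (φ (1 / (m : ℝ))) ^ θ) →
      ∃ K : ℝ≥0∞, K ≠ ∞ ∧ ∀ n : ℕ, weightedSum θ r lam A (1 / (2 : ℝ) ^ n)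
        ≤ K * ENNReal.ofReal (φ (1 / (2 : ℝ) ^ n)) ^ θ := by
    rintro ⟨K, hK, hb⟩
    refine ⟨K, hK, fun n => ?_⟩
    simpa using hb (2 ^ n) Nat.one_le_two_pow
  have toClass : (∃ K : ℝ≥0∞, K ≠ ∞ ∧ ∀ n : ℕ, weightedSum θ r lam A (1 / (2 : ℝ) ^ n)
      ≤ K * ENNReal.ofReal (φ (1 / (2 : ℝ) ^ n)) ^ θ) → f ∈ classN p θ r lam k φ := by
    rintro ⟨K, hK, hb⟩
    exact hclass.2 (weightedSum_bound_Ioo_of_dyadic hθ hlam hφ hK hb)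
  have hcoeff' : (∃ C : ℝ, 0 < C ∧ ∀ m : ℕ, 1 ≤ m →
      coeffSum θ r lam c m ^ (1 / θ) ≤ ENNReal.ofReal (C * φ (1 / (m : ℝ)))) ↔
      ∃ K : ℝ≥0∞, K ≠ ∞ ∧ ∀ m : ℕ, 1 ≤ m →
        weightedSum θ r lam A (1 / (m : ℝ)) ≤ K * ENNReal.ofReal (φ (1 / (m : ℝ))) ^ θ := by
    refine hcoeff.trans (exists_congr fun K => and_congr_right fun _ =>
      forall₂_congr fun m hm => ?_)
    rw [coeffSum_eq hθ hr hlam hca hm]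
  have hdyad' : (∃ C : ℝ, 0 < C ∧ ∀ n : ℕ,
      dyadicSum θ r lam a n ≤ ENNReal.ofReal (C * φ (1 / (2 : ℝ) ^ n) ^ θ)) ↔
      ∃ K : ℝ≥0∞, K ≠ ∞ ∧ ∀ n : ℕ, weightedSum θ r lam A (1 / (2 : ℝ) ^ n)
        ≤ K * ENNReal.ofReal (φ (1 / (2 : ℝ) ^ n)) ^ θ := by
    refine hdyad.trans (exists_congr fun K => and_congr_right fun _ =>
      forall_congr' fun n => ?_)
    rw [dyadicSum_eq hθ hlam fun n => (hca.1 n).1]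
  rw [hcoeff', hdyad']
  -- Both equivalences come from one cycle: class, all `m`, powers of two, class.
  exact ⟨⟨toNat, fun h => toClass (toDyadic h)⟩, ⟨fun h => toDyadic (toNat h), toClass⟩⟩
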